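/- **Setting.** Let $X=(x_i)_{i\in[n]}$ be points in $\mathbb{R}^d$ and let $\Gamma$ be a partition of $[n]$ into $k$ nonempty clusters. For nonempty $S\subseteq[n]$ let $c_S=\frac1{|S|}\sum_{i\in S}x_i$. For distinct $S,T\in\Gamma$ put $$\alpha_{ST}=\min_{i\in S}\Big\langle x_i-\tfrac{c_S+c_T}{2},\tfrac{c_S-c_T}{\|c_S-c_T\|}\Big\rangle,\qquad \beta_{ST}=\tfrac12\Big(\big(\tfrac1{|S|}+\tfrac1{|T|}\big)\sum_{R\in\Gamma}\|X_R\|_{2\to2}^2\Big)^{1/2},$$ where $X_R$ is the $d\times n$ matrix whose $i$th column is $x_i-c_R$ if $i\in R$ and $0$ otherwise (the unit vector in $\alpha_{ST}$ is read as $0$ if $c_S=c_T$). Put $\operatorname{prox}(X,\Gamma)=\min_{S\ne T}(\alpha_{ST}-\beta_{ST})$, $\Delta=\min_{S\neq T}\|c_S-c_T\|$ (both $+\infty$ if $k\le 1$), $r=\max_{S\in\Gamma}\max_{i\in S}\|x_i-c_S\|$, $\pi_{\min}=\frac1n\min_{S\in\Gamma}|S|$ and $\pi_{\max}=\frac1n\max_{S\in\Gamma}|S|$.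 **Shape parameter.** For $\delta,\rho\in[0,\infty]$ let $L_1=\frac{2}{\log 2}\log(36k^3(d+1))$, $L_2=\frac{2}{\log 2}\log(8k^2(d+2))$, $$A=\Big(\frac2\delta+\frac32\Big)\cdot 8\sqrt{\frac{L_2}{\pi_{\min}}},\qquad B=\frac12\Big(\big(16\sqrt3+\sqrt{104/3}\big)\,k\,\frac{\pi_{\max}}{\pi_{\min}}\sqrt{\frac{L_1}{\pi_{\min}}}\Big)^{1/2},$$ $$c_1=\frac{48}{\pi_{\min}}\Big(\frac{\pi_{\max}}{\pi_{\min}}\Big)^2L_1,\qquad c_2=\Big(\frac{B}{2\rho}+\sqrt{\Big(\frac{B}{2\rho}\Big)^2+\frac A\rho}\Big)^4$$ (for $0<\rho<\infty$, $c>c_2$ if and only if $\rho>A c^{-1/2}+B c^{-1/4}$), and $F(d,\delta,\rho,k,\pi_{\min},\pi_{\max})=\max\{c_1,c_2\}\in[0,\infty]$. The explicit shape parameter is $$C(X,\Gamma)=F\Big(d,\frac{\Delta}{r},\frac{\max\{\operatorname{prox}(X,\Gamma),0\}}{r},k,\pi_{\min},\pi_{\max}\Big),$$ with the conventions of $[0,\infty]$: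 $a/0=\infty$ for $a>0$, $0/0=0$, $a/\infty=0$ and $0\cdot\infty=0$. **Algorithm.** Draw $W\subseteq[n]$ by including each index independently with probability $p\in[0,1]$. Minimize $\frac1{2|W|}\operatorname{tr}(D_{X'}Z)$, where $(D_{X'})_{ij}=\|x_i-x_j\|^2$ for $i,j\in W$, over all positive semidefinite $Z\in\mathbb{R}^{W\times W}$ with nonnegative entries, $Z1=1$ and $\operatorname{tr}Z=k$. If the solution is $Z_{\Gamma'}=\sum_{S'\in\Gamma'}\frac1{|S'|}1_{S'}1_{S'}^\top$ for a partition $\Gamma'$ of $W$ into $k$ nonempty sets, partition $[n]$ by assigning each $i$ to a set $S'\in\Gamma'$ whose centroid $c_{S'}$ is closest to $x_i$. The algorithm *exactly recovers* $\Gamma$ if the program has a solution, every solution has the form $Z_{\Gamma'}$, and the resulting partition of $[n]$ is $\Gamma$, however ties in the assignment are broken. **Theorem.** (a) If $\operatorname{prox}(X,\Gamma)>0$ and $r\le\Delta/2$, then $C(X,\Gamma)<\infty$, and for every $\epsilon\in(0,\frac12)$ and every rate $p\in[0,1]$ with $\mathbb{E}|W|>C(X,\Gamma)\cdot\log(1/\epsilon)$,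 the algorithm exactly recovers $\Gamma$ from $X$ with probability at least $1-\epsilon$. (b) $F$ is nondecreasing in $d$, in $k$ and in the largest cluster fraction $\pi_{\max}$, and nonincreasing in $\Delta/r$ (the argument $\delta$), in $\operatorname{prox}(X,\Gamma)/r$ (the argument $\rho$) and in the smallest cluster fraction $\pi_{\min}$. -/

import Mathlib

open MeasureTheory ProbabilityTheory
open scoped ENNReal

namespace SketchSolve

noncomputable section

/-! A `k`-clustering of `W ⊆ [n]` (an element of `Π(|W|, k)`) is a `Γ : Finpartition W` with
`Γ.parts.card = k`; the parts of a `Finpartition` are nonempty, pairwise disjoint, and cover `W`. -/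

/-! ### Centroids and the proximity condition -/

/-- The centroid `c_S` of the points indexed by `S`. -/
def centroid {n d : ℕ} (X : Fin n → EuclideanSpace ℝ (Fin d)) (S : Finset (Fin n)) :
    EuclideanSpace ℝ (Fin d) :=
  (S.card : ℝ)⁻¹ • ∑ i ∈ S, X i

/-- The quantity `α_{ST}`: the minimum over `i ∈ S` of
`⟨x_i - (c_S + c_T)/2, (c_S - c_T)/‖c_S - c_T‖⟩`. -/
def alpha {n d : ℕ} (X : Fin n → EuclideanSpace ℝ (Fin d)) (S T : Finset (Fin n)) : ℝ :=
  ⨅ i : S, inner ℝ (X i - (1 / 2 : ℝ) • (centroid X S + centroid X T))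
    (‖centroid X S - centroid X T‖⁻¹ • (centroid X S - centroid X T))

/-- The `d × n` matrix `X_R` whose `i`th column is `x_i - c_R` if `i ∈ R`, and zero otherwise. -/
def centeredMatrix {n d : ℕ} (X : Fin n → EuclideanSpace ℝ (Fin d)) (R : Finset (Fin n)) :
    Matrix (Fin d) (Fin n) ℝ :=
  Matrix.of fun a i => if i ∈ R then (X i - centroid X R) a else 0

open scoped Matrix.Norms.L2Operator in
/-- The operator norm `‖A‖_{2→2}` (largest singular value) of a real matrix. -/
def spectralNorm {d n : ℕ} (A : Matrix (Fin d) (Fin n) ℝ) : ℝ := ‖A‖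

/-- The quantity `β_{ST} = ½ ((1/|S| + 1/|T|) ∑_{R ∈ Γ} ‖X_R‖_{2→2}²)^{1/2}`. -/
def beta {n d : ℕ} (X : Fin n → EuclideanSpace ℝ (Fin d))
    (Γ : Finpartition (Finset.univ : Finset (Fin n))) (S T : Finset (Fin n)) : ℝ :=
  (1 / 2) * Real.sqrt ((1 / (S.card : ℝ) + 1 / (T.card : ℝ)) *
    ∑ R ∈ Γ.parts, spectralNorm (centeredMatrix X R) ^ 2)

/-- `prox(X, Γ)`, the minimum of `α_{ST} - β_{ST}` over distinct `S, T ∈ Γ` (`+∞` when there is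
only one cluster). -/
def prox {n d : ℕ} (X : Fin n → EuclideanSpace ℝ (Fin d))
    (Γ : Finpartition (Finset.univ : Finset (Fin n))) : EReal :=
  ⨅ S ∈ Γ.parts, ⨅ T ∈ Γ.parts, ⨅ _ : S ≠ T, ((alpha X S T - beta X Γ S T : ℝ) : EReal)

/-- `Δ`, the minimum distance between distinct centroids (`∞` when there is only one cluster). -/
def separation {n d : ℕ} (X : Fin n → EuclideanSpace ℝ (Fin d))
    (Γ : Finpartition (Finset.univ : Finset (Fin n))) : ℝ≥0∞ :=
  ⨅ S ∈ Γ.parts, ⨅ T ∈ Γ.parts, ⨅ _ : S ≠ T, edist (centroid X S) (centroid X T)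

/-- `r`, the maximum distance of a data point to the centroid of its cluster. -/
def radius {n d : ℕ} (X : Fin n → EuclideanSpace ℝ (Fin d))
    (Γ : Finpartition (Finset.univ : Finset (Fin n))) : ℝ≥0∞ :=
  ⨆ S ∈ Γ.parts, ⨆ i ∈ S, edist (X i) (centroid X S)

/-- The smallest cluster fraction `(1/n) min_{S ∈ Γ} |S|`. -/
def minFraction {n : ℕ} (Γ : Finpartition (Finset.univ : Finset (Fin n))) : ℝ≥0∞ :=
  ⨅ S ∈ Γ.parts, (S.card : ℝ≥0∞) / (n : ℝ≥0∞)

/-- The largest cluster fraction `(1/n) max_{S ∈ Γ} |S|`. -/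
def maxFraction {n : ℕ} (Γ : Finpartition (Finset.univ : Finset (Fin n))) : ℝ≥0∞ :=
  ⨆ S ∈ Γ.parts, (S.card : ℝ≥0∞) / (n : ℝ≥0∞)

/-! ### The shape parameter -/

/-- `(2 / log 2) · log(36 k³ (d + 1))`. -/
def logTerm₁ (d k : ℕ) : ℝ≥0∞ :=
  ENNReal.ofReal (2 / Real.log 2 * Real.log (36 * (k : ℝ) ^ 3 * ((d : ℝ) + 1)))

/-- `(2 / log 2) · log(8 k² (d + 2))`. -/
def logTerm₂ (d k : ℕ) : ℝ≥0∞ :=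
  ENNReal.ofReal (2 / Real.log 2 * Real.log (8 * (k : ℝ) ^ 2 * ((d : ℝ) + 2)))

/-- The first threshold `c₁`: the least `c` with `c · πmin ≥ 48 (πmax/πmin)² · logTerm₁`. -/
def threshold₁ (d k : ℕ) (πmin πmax : ℝ≥0∞) : ℝ≥0∞ :=
  48 * (πmax / πmin) ^ 2 * logTerm₁ d k / πmin

/-- The coefficient `A = (2/δ + 3/2) · 8 · (logTerm₂/πmin)^{1/2}`, where `δ` stands for `Δ/r`. -/
def coeffA (d : ℕ) (δ : ℝ≥0∞) (k : ℕ) (πmin : ℝ≥0∞) : ℝ≥0∞ :=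
  (2 / δ + 3 / 2) * 8 * (logTerm₂ d k / πmin) ^ (1 / 2 : ℝ)

/-- The coefficient
`B = ½ ((16√3 + √(104/3)) · k · (πmax/πmin) · (logTerm₁/πmin)^{1/2})^{1/2}`. -/
def coeffB (d k : ℕ) (πmin πmax : ℝ≥0∞) : ℝ≥0∞ :=
  1 / 2 * (ENNReal.ofReal (16 * Real.sqrt 3 + Real.sqrt (104 / 3)) * (k : ℝ≥0∞) * (πmax / πmin) *
    (logTerm₁ d k / πmin) ^ (1 / 2 : ℝ)) ^ (1 / 2 : ℝ)

/-- The second threshold `c₂`: the solution `c` of `ρ = A / c^{1/2} + B / c^{1/4}`, where `ρ`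
stands for `prox(X, Γ)/r`; that is, `ρ > A / c^{1/2} + B / c^{1/4}` if and only if `c > c₂`. -/
def threshold₂ (d : ℕ) (δ ρ : ℝ≥0∞) (k : ℕ) (πmin πmax : ℝ≥0∞) : ℝ≥0∞ :=
  (coeffB d k πmin πmax / (2 * ρ) +
    ((coeffB d k πmin πmax / (2 * ρ)) ^ 2 + coeffA d δ k πmin / ρ) ^ (1 / 2 : ℝ)) ^ 4

/-- The explicit function `max {c₁, c₂}` of `d`, `δ = Δ/r`, `ρ = prox(X, Γ)/r`, `k`, and the
smallest and largest cluster fractions. -/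
def shapeFunction (d : ℕ) (δ ρ : ℝ≥0∞) (k : ℕ) (πmin πmax : ℝ≥0∞) : ℝ≥0∞ :=
  max (threshold₁ d k πmin πmax) (threshold₂ d δ ρ k πmin πmax)

/-- The shape parameter `C(X, Γ)`.  The ratios are extended-real: a positive number divided by
`r = 0` is `∞`, and a negative value of `prox(X, Γ)` is treated as `0`. -/
def shapeParameter {n d : ℕ} (X : Fin n → EuclideanSpace ℝ (Fin d))
    (Γ : Finpartition (Finset.univ : Finset (Fin n))) : ℝ≥0∞ :=
  shapeFunction d (separation X Γ / radius X Γ) ((prox X Γ).toENNReal / radius X Γ)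
    Γ.parts.card (minFraction Γ) (maxFraction Γ)

/-! ### The Peng--Wei semidefinite program on the sketch `{x_i}_{i ∈ W}` -/

/-- The squared distance matrix `D_{X'}` of the sketch. -/
def sqDistMatrix {n d : ℕ} (X : Fin n → EuclideanSpace ℝ (Fin d)) (W : Finset (Fin n)) :
    Matrix W W ℝ :=
  Matrix.of fun i j => ‖X i - X j‖ ^ 2

/-- The feasible set: `Z 1 = 1`, `tr Z = k`, `Z ≥ 0` entrywise, `Z ⪰ 0`. -/
def pengWeiFeasible {n : ℕ} (W : Finset (Fin n)) (k : ℕ) : Set (Matrix W W ℝ) :=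
  {Z | Matrix.mulVec Z 1 = 1 ∧ Z.trace = (k : ℝ) ∧ (∀ i j, 0 ≤ Z i j) ∧ Z.PosSemidef}

/-- The objective `(1 / (2|W|)) tr(D_{X'} Z)`. -/
def pengWeiObjective {n d : ℕ} (X : Fin n → EuclideanSpace ℝ (Fin d)) (W : Finset (Fin n))
    (Z : Matrix W W ℝ) : ℝ :=
  1 / (2 * (W.card : ℝ)) * (sqDistMatrix X W * Z).trace

/-- `Z` is a minimizer of the Peng--Wei semidefinite program for the sketch. -/
def IsPengWeiSolution {n d : ℕ} (X : Fin n → EuclideanSpace ℝ (Fin d)) (W : Finset (Fin n))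
    (k : ℕ) (Z : Matrix W W ℝ) : Prop :=
  Z ∈ pengWeiFeasible W k ∧
    ∀ Z' ∈ pengWeiFeasible W k, pengWeiObjective X W Z ≤ pengWeiObjective X W Z'

/-- The matrix `Z_Γ = ∑_{S ∈ Γ} (1/|S|) 1_S 1_Sᵀ`. -/
def clusterMatrix {n : ℕ} {W : Finset (Fin n)} (Γ : Finpartition W) : Matrix W W ℝ :=
  ∑ S ∈ Γ.parts, (S.card : ℝ)⁻¹ •
    Matrix.vecMulVec (fun i : W => if (i : Fin n) ∈ S then (1 : ℝ) else 0)
      (fun j : W => if (j : Fin n) ∈ S then (1 : ℝ) else 0)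

/-! ### The sketch-and-solve algorithm -/

/-- `σ` assigns every one of the `n` data points to a cluster of `Γ'` with closest centroid (any
way of breaking ties is allowed). -/
def IsNearestAssignment {n d : ℕ} (X : Fin n → EuclideanSpace ℝ (Fin d)) {W : Finset (Fin n)}
    (Γ' : Finpartition W) (σ : Fin n → Finset (Fin n)) : Prop :=
  ∀ i, σ i ∈ Γ'.parts ∧
    ∀ T ∈ Γ'.parts, ‖X i - centroid X (σ i)‖ ≤ ‖X i - centroid X T‖

/-- The clusters of `[n]` that an assignment `σ` to the clusters of `Γ'` produces. -/
def outputClusters {n : ℕ} {W : Finset (Fin n)} (Γ' : Finpartition W)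
    (σ : Fin n → Finset (Fin n)) : Finset (Finset (Fin n)) :=
  Γ'.parts.image fun T => Finset.univ.filter fun i => σ i = T

/-- On the sketch `W`, the algorithm exactly recovers `Γ`: the semidefinite program has a solution;
every solution is `Z_{Γ'}` for some `k`-clustering `Γ'` of the sketch; and assigning all points of
`X` to the closest centroid of `Γ'` yields `Γ`, however ties might be broken. -/
def ExactlyRecovers {n d : ℕ} (X : Fin n → EuclideanSpace ℝ (Fin d)) (k : ℕ)
    (W : Finset (Fin n)) (Γ : Finpartition (Finset.univ : Finset (Fin n))) : Prop :=
  (∃ Z, IsPengWeiSolution X W k Z) ∧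
    ∀ Z, IsPengWeiSolution X W k Z →
      ∃ Γ' : Finpartition W, Γ'.parts.card = k ∧ Z = clusterMatrix Γ' ∧
        ∀ σ, IsNearestAssignment X Γ' σ → outputClusters Γ' σ = Γ.parts

/-- The law of the Bernoulli sketch `W ⊆ [n]` with rate `p`: each index belongs to `W`
independently with probability `p`. -/
def sketchLaw (n : ℕ) (p : unitInterval) : Measure (Set (Fin n)) :=
  setBernoulli Set.univ p

/-- The expected sketch size `𝔼|W|`. -/
def expectedSketchSize (n : ℕ) (p : unitInterval) : ℝ≥0∞ :=
  ∫⁻ W, (W.ncard : ℝ≥0∞) ∂(sketchLaw n p)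

/-- The event that the algorithm exactly recovers `Γ` from `X`. -/
def recoveryEvent {n d : ℕ} (X : Fin n → EuclideanSpace ℝ (Fin d)) (k : ℕ)
    (Γ : Finpartition (Finset.univ : Finset (Fin n))) : Set (Set (Fin n)) :=
  {W | ExactlyRecovers X k W.toFinite.toFinset Γ}

end

end SketchSolve

/-! A deterministic recovery criterion is combined with a dimension-free sampling estimate.

Deterministic side. Suppose every cluster meets the sketch. The squared distance matrix splits into
a form that pairs nonnegatively with positive semidefinite matrices, a matrix `B` that vanishes
within clusters and is positive across them, and terms whose pairing with a feasible `Z` is fixed by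
its row sums and trace. Across clusters the form uses the reflection in the bisector of the two
centroids, and proximity is what makes `B` positive there. Hence every feasible `Z` costs at least
the planted cost plus `⟨Z, B⟩` (`exists_dual_certificate`). A minimizer therefore vanishes across
clusters and equals the planted projection (`eq_labelMatrix`). Requiring proximity also of
unsketched points puts them strictly closest to the right centroid (`exactlyRecovers_of_proximity`).

Random side. Let `m` be the smallest cluster size. If cluster sizes, centered sums and centered
second moments of the sketch are within a relative error `2s` of their expectations, then sketched
centroids move by `O(rs)` and `β` grows by `O(r √(sn/m))`, which the margin `prox` absorbs
(`exactlyRecovers_of_isRepresentative`). All three deviations are sums of independent vectors in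
inner product spaces, second moments being taken in the Frobenius norm, so one Pinelis-type
inequality (`sketchLaw_norm_deviation_le`) controls them. With `Λ = L₂ log(1/ε)` and `s =
√(Λ/(pm))`, the failure probability is at most `6k e^{-Λ} ≤ ε`.

The margin requirement is a quadratic inequality in `(pn / log(1/ε))^{1/4}`, implied by exceeding
`c₂`; `c₁` keeps `s ≤ 1/4`. Monotonicity of `F` is read off its formula, and it also serves to pass
from the minima over all pairs of clusters to a single pair. -/

namespace SketchSolve

/-! ### Concentration of Bernoulli sums in inner product spaces -/

section Concentration

variable {H : Type*} [NormedAddCommGroup H] [InnerProductSpace ℝ H]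

/-- The function `t ↦ cosh √t` has a power series with nonnegative coefficients, hence is convex on
`t ≥ 0`; the comparison is made term by term. -/
theorem cosh_le_of_sq_eq_convexCombination {s u v a b : ℝ} (ha : 0 ≤ a) (hb : 0 ≤ b)
    (hab : a + b = 1) (hs : s ^ 2 = a * u ^ 2 + b * v ^ 2) :
    Real.cosh s ≤ a * Real.cosh u + b * Real.cosh v := by
  refine hasSum_le (fun m => ?_) (Real.hasSum_cosh s)
    (((Real.hasSum_cosh u).mul_left a).add ((Real.hasSum_cosh v).mul_left b))
  have h := (convexOn_pow (𝕜 := ℝ) m).2 (Set.mem_Ici.2 (sq_nonneg u)) (Set.mem_Ici.2 (sq_nonneg v))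
    ha hb hab
  simp only [smul_eq_mul] at h
  rw [← hs] at h
  simp only [pow_mul]
  calc (s ^ 2) ^ m / ((2 * m).factorial : ℝ)
      ≤ (a * (u ^ 2) ^ m + b * (v ^ 2) ^ m) / ((2 * m).factorial : ℝ) := by gcongr
    _ = _ := by ring

/-- Pinelis' one-step bound for the hyperbolic cosine of the norm in an inner product space. -/
theorem cosh_norm_add_le (x y : H) :
    Real.cosh ‖x + y‖ ≤ Real.cosh ‖x‖ * (Real.exp ‖y‖ - ‖y‖) +
      inner ℝ x y * (Real.sinh ‖x‖ / ‖x‖) := by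
  have hsy : ‖y‖ ≤ Real.sinh ‖y‖ := Real.self_le_sinh_iff.2 (norm_nonneg y)
  have hexp : Real.exp ‖y‖ - ‖y‖ = Real.cosh ‖y‖ + (Real.sinh ‖y‖ - ‖y‖) := by
    rw [← Real.cosh_add_sinh]; ring
  rcases eq_or_ne x 0 with rfl | hx
  · simp only [zero_add, norm_zero, Real.cosh_zero, one_mul, inner_zero_left, zero_mul, add_zero]
    rw [hexp]; linarith
  rcases eq_or_ne y 0 with rfl | hy
  · simp
  have hx0 : 0 < ‖x‖ := norm_pos_iff.2 hx
  have hy0 : 0 < ‖y‖ := norm_pos_iff.2 hy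
  set θ : ℝ := inner ℝ x y / (‖x‖ * ‖y‖) with hθ
  have hin : inner ℝ x y = θ * ‖x‖ * ‖y‖ := by rw [hθ]; field_simp
  have hθ1 : |θ| ≤ 1 := abs_real_inner_div_norm_mul_norm_le_one x y
  obtain ⟨h1, h2⟩ := abs_le.1 hθ1
  -- With `θ` the cosine of the angle, `‖x + y‖²` is the average of `(‖x‖ ± ‖y‖)²` with weights `(1
  -- ± θ)/2`.
  have key := cosh_le_of_sq_eq_convexCombination (s := ‖x + y‖) (u := ‖x‖ + ‖y‖)
    (v := ‖x‖ - ‖y‖) (a := (1 + θ) / 2) (b := (1 - θ) / 2) (by linarith) (by linarith) (by ring)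
    (by rw [norm_add_sq_real, hin]; ring)
  rw [Real.cosh_add, Real.cosh_sub] at key
  have hsx : 0 ≤ Real.sinh ‖x‖ := Real.sinh_nonneg_iff.2 hx0.le
  -- Only the excess `sinh ‖y‖ - ‖y‖` is absorbed into `cosh ‖x‖`; the part linear in `y` stays
  -- exact so that it cancels on averaging.
  have hθs : θ * Real.sinh ‖x‖ ≤ Real.cosh ‖x‖ := by
    have := (Real.sinh_lt_cosh ‖x‖).le
    nlinarith
  have h3 := mul_le_mul_of_nonneg_right hθs (sub_nonneg.2 hsy)
  have h4 : inner ℝ x y * (Real.sinh ‖x‖ / ‖x‖) = θ * ‖y‖ * Real.sinh ‖x‖ := by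
    rw [hin]; field_simp
  rw [h4, hexp]
  nlinarith

theorem exp_sub_self_le {t : ℝ} (h0 : 0 ≤ t) (h1 : t ≤ 1) : Real.exp t - t ≤ 1 + t ^ 2 := by
  have := Real.abs_exp_sub_one_sub_id_le (abs_le.2 ⟨by linarith, h1⟩)
  linarith [(abs_le.1 this).2]

/-- The increment has mean zero, so the linear terms of `cosh_norm_add_le` cancel and only the
variance `p(1-p)‖v‖²` remains. -/
theorem bernoulli_cosh_norm_le {p : ℝ} (hp0 : 0 ≤ p) (hp1 : p ≤ 1) (x v : H) (hv : ‖v‖ ≤ 1) :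
    (1 - p) * Real.cosh ‖x - p • v‖ + p * Real.cosh ‖x + (1 - p) • v‖ ≤
      Real.cosh ‖x‖ * Real.exp (p * ‖v‖ ^ 2) := by
  have hq : 0 ≤ 1 - p := by linarith
  have hv0 := norm_nonneg v
  have e1 : ‖-(p • v)‖ = p * ‖v‖ := by rw [norm_neg, norm_smul, Real.norm_of_nonneg hp0]
  have e2 : ‖(1 - p) • v‖ = (1 - p) * ‖v‖ := by rw [norm_smul, Real.norm_of_nonneg hq]
  have k1 := cosh_norm_add_le x (-(p • v))
  have k2 := cosh_norm_add_le x ((1 - p) • v)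
  rw [e1, inner_neg_right, inner_smul_right] at k1
  rw [e2, inner_smul_right] at k2
  rw [← sub_eq_add_neg] at k1
  have b1 := exp_sub_self_le (t := p * ‖v‖) (by positivity) (by nlinarith)
  have b2 := exp_sub_self_le (t := (1 - p) * ‖v‖) (by positivity) (by nlinarith)
  have hc : 0 < Real.cosh ‖x‖ := Real.cosh_pos _
  have hE : p * ‖v‖ ^ 2 + 1 ≤ Real.exp (p * ‖v‖ ^ 2) := Real.add_one_le_exp _
  calc _ ≤ (1 - p) * (Real.cosh ‖x‖ * (1 + (p * ‖v‖) ^ 2) +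
            -(p * inner ℝ x v) * (Real.sinh ‖x‖ / ‖x‖)) +
          p * (Real.cosh ‖x‖ * (1 + ((1 - p) * ‖v‖) ^ 2) +
            (1 - p) * inner ℝ x v * (Real.sinh ‖x‖ / ‖x‖)) := by
        gcongr
        · exact k1.trans (by gcongr)
        · exact k2.trans (by gcongr)
    _ = Real.cosh ‖x‖ * (1 + p * (1 - p) * ‖v‖ ^ 2) := by ring
    _ ≤ Real.cosh ‖x‖ * Real.exp (p * ‖v‖ ^ 2) := by
        gcongr
        nlinarith [mul_nonneg (mul_nonneg hp0 hp0) (sq_nonneg ‖v‖)]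

/-- The sum is an expectation over Bernoulli subsets of `s`. Indices are revealed one at a time,
with `x` carrying the partial sum. -/
theorem sum_powerset_cosh_norm_le {ι : Type*} [DecidableEq ι] {p : ℝ} (hp0 : 0 ≤ p) (hp1 : p ≤ 1)
    (v : ι → H) (hv : ∀ i, ‖v i‖ ≤ 1) (s : Finset ι) (x : H) :
    ∑ T ∈ s.powerset, p ^ T.card * (1 - p) ^ (s \ T).card *
        Real.cosh ‖x + (∑ i ∈ T, v i - p • ∑ i ∈ s, v i)‖ ≤
      Real.cosh ‖x‖ * Real.exp (p * ∑ i ∈ s, ‖v i‖ ^ 2) := by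
  induction s using Finset.induction_on generalizing x with
  | empty => simp
  | insert a s ha ih =>
    rw [Finset.sum_powerset_insert ha]
    have hq : 0 ≤ 1 - p := by linarith
    have i1 := mul_le_mul_of_nonneg_left (ih (x - p • v a)) hq
    have i2 := mul_le_mul_of_nonneg_left (ih (x + (1 - p) • v a)) hp0
    have e1 : ∑ T ∈ s.powerset, p ^ T.card * (1 - p) ^ (insert a s \ T).card *
        Real.cosh ‖x + (∑ i ∈ T, v i - p • ∑ i ∈ insert a s, v i)‖ =
        (1 - p) * ∑ T ∈ s.powerset, p ^ T.card * (1 - p) ^ (s \ T).card *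
          Real.cosh ‖x - p • v a + (∑ i ∈ T, v i - p • ∑ i ∈ s, v i)‖ := by
      rw [Finset.mul_sum]
      refine Finset.sum_congr rfl fun T hT => ?_
      have haT : a ∉ T := fun h => ha (Finset.mem_powerset.1 hT h)
      rw [Finset.insert_sdiff_of_notMem _ haT, Finset.card_insert_of_notMem (by simp [ha]),
        Finset.sum_insert ha, smul_add,
        show x + (∑ i ∈ T, v i - (p • v a + p • ∑ i ∈ s, v i)) =
          x - p • v a + (∑ i ∈ T, v i - p • ∑ i ∈ s, v i) by abel]
      ring
    have e2 : ∑ T ∈ s.powerset, p ^ (insert a T).card * (1 - p) ^ (insert a s \ insert a T).card *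
        Real.cosh ‖x + (∑ i ∈ insert a T, v i - p • ∑ i ∈ insert a s, v i)‖ =
        p * ∑ T ∈ s.powerset, p ^ T.card * (1 - p) ^ (s \ T).card *
          Real.cosh ‖x + (1 - p) • v a + (∑ i ∈ T, v i - p • ∑ i ∈ s, v i)‖ := by
      rw [Finset.mul_sum]
      refine Finset.sum_congr rfl fun T hT => ?_
      have haT : a ∉ T := fun h => ha (Finset.mem_powerset.1 hT h)
      have hsd : insert a s \ insert a T = s \ T := by
        ext i
        simp only [Finset.mem_sdiff, Finset.mem_insert]
        constructor
        · rintro ⟨h1, h2⟩; tauto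
        · rintro ⟨h1, h2⟩
          exact ⟨Or.inr h1, fun h => h.elim (fun h => ha (h ▸ h1)) h2⟩
      rw [hsd, Finset.card_insert_of_notMem haT, Finset.sum_insert ha, Finset.sum_insert haT,
        smul_add, sub_smul, one_smul,
        show x + (v a + ∑ i ∈ T, v i - (p • v a + p • ∑ i ∈ s, v i)) =
          x + (v a - p • v a) + (∑ i ∈ T, v i - p • ∑ i ∈ s, v i) by abel]
      ring
    rw [e1, e2, Finset.sum_insert ha, mul_add, Real.exp_add, ← mul_assoc]
    have h3 := mul_le_mul_of_nonneg_right (bernoulli_cosh_norm_le hp0 hp1 x (v a) (hv a))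
      (Real.exp_pos (p * ∑ i ∈ s, ‖v i‖ ^ 2)).le
    linarith

theorem sketchLaw_real_eq_sum {n : ℕ} (p : unitInterval) (E : Set (Set (Fin n))) :
    (sketchLaw n p).real E =
      ∑ T ∈ (Finset.univ : Finset (Fin n)).powerset,
        (p : ℝ) ^ T.card * (1 - p : ℝ) ^ (Finset.univ \ T).card *
          (open scoped Classical in if (T : Set (Fin n)) ∈ E then 1 else 0) := by
  classical
  have hE : E = ⋃ T ∈ Finset.univ.filter (fun T : Finset (Fin n) => (T : Set (Fin n)) ∈ E),
      {(T : Set (Fin n))} := by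
    ext W
    simp only [Finset.mem_filter, Finset.mem_univ, true_and, Set.mem_iUnion, Set.mem_singleton_iff,
      exists_prop]
    constructor
    · intro h
      exact ⟨W.toFinite.toFinset, by simpa using h, by simp⟩
    · rintro ⟨T, hT, rfl⟩; exact hT
  conv_lhs => rw [hE]
  rw [measureReal_biUnion_finset (h := fun T _ => by rw [sketchLaw]; exact measure_ne_top _ _)]
  · rw [Finset.powerset_univ, Finset.sum_filter]
    refine Finset.sum_congr rfl fun T _ => ?_
    split_ifs
    · rw [sketchLaw, setBernoulli_real_singleton p (Set.subset_univ _) Set.finite_univ,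
        Set.ncard_coe_finset, mul_one]
      congr 2
      rw [← Finset.coe_univ, ← Finset.coe_sdiff, Set.ncard_coe_finset]
    · simp
  · intro A _ B _ hAB
    simpa [Function.onFun] using hAB
  · intro T _
    exact MeasurableSet.singleton _

/-- A dimension-free Bernstein inequality for Bernoulli sampling in an inner product space. -/
theorem sketchLaw_norm_deviation_le {n : ℕ} (p : unitInterval) (v : Fin n → H) {r N Λ : ℝ}
    (hr : 0 < r) (hv : ∀ i, ‖v i‖ ≤ r) (hN : (p : ℝ) * ∑ i, ‖v i‖ ^ 2 ≤ N * r ^ 2)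
    (hN0 : 0 < N) (hΛ0 : 0 ≤ Λ) (hΛ : Λ ≤ N) :
    (sketchLaw n p).real {W | 2 * r * Real.sqrt (N * Λ) <
        ‖∑ i ∈ W.toFinite.toFinset, v i - (p : ℝ) • ∑ i, v i‖} ≤ 2 * Real.exp (-Λ) := by
  classical
  -- This tilt minimizes the exponent `λ²N - 2λ√(NΛ)`; `Λ ≤ N` makes `λ ≤ 1`, so the rescaled
  -- vectors stay in the unit ball.
  set lam : ℝ := Real.sqrt (Λ / N) with hlam
  have hl0 : 0 ≤ lam := Real.sqrt_nonneg _
  have hl1 : lam ≤ 1 := Real.sqrt_le_one.2 ((div_le_one hN0).2 hΛ)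
  have hl2 : lam ^ 2 * N = Λ := by
    rw [hlam, Real.sq_sqrt (by positivity)]; field_simp
  have hl3 : lam * Real.sqrt (N * Λ) = Λ := by
    rw [hlam, ← Real.sqrt_mul (by positivity), show Λ / N * (N * Λ) = Λ ^ 2 by field_simp,
      Real.sqrt_sq hΛ0]
  have hc : 0 ≤ lam / r := by positivity
  have hmgf := sum_powerset_cosh_norm_le (p := (p : ℝ)) p.2.1 p.2.2 (fun i => (lam / r) • v i)
    (fun i => by
      rw [norm_smul, Real.norm_of_nonneg hc, div_mul_eq_mul_div, div_le_one hr]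
      nlinarith [hv i, norm_nonneg (v i)]) Finset.univ (0 : H)
  have hvar : (p : ℝ) * ∑ i, ‖(lam / r) • v i‖ ^ 2 ≤ Λ := by
    have : ∀ i, ‖(lam / r) • v i‖ ^ 2 = (lam / r) ^ 2 * ‖v i‖ ^ 2 := fun i => by
      rw [norm_smul, Real.norm_of_nonneg hc, mul_pow]
    simp only [this, ← Finset.mul_sum]
    calc (p : ℝ) * ((lam / r) ^ 2 * ∑ i, ‖v i‖ ^ 2)
        = (lam / r) ^ 2 * ((p : ℝ) * ∑ i, ‖v i‖ ^ 2) := by ring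
      _ ≤ (lam / r) ^ 2 * (N * r ^ 2) := by gcongr
      _ = Λ := by rw [← hl2]; field_simp
  have hmgf' := hmgf.trans (mul_le_mul_of_nonneg_left (Real.exp_le_exp.2 hvar)
    (Real.cosh_pos _).le)
  simp only [zero_add, norm_zero, Real.cosh_zero, one_mul, ← Finset.smul_sum] at hmgf'
  -- Markov's inequality: on the event the hyperbolic cosine is at least `e^{2Λ}/2`, while its mean
  -- is at most `e^Λ`.
  have hmarkov : (sketchLaw n p).real {W | 2 * r * Real.sqrt (N * Λ) <
      ‖∑ i ∈ W.toFinite.toFinset, v i - (p : ℝ) • ∑ i, v i‖} * (Real.exp (2 * Λ) / 2) ≤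
      Real.exp Λ := by
    refine le_trans ?_ hmgf'
    rw [sketchLaw_real_eq_sum, Finset.sum_mul]
    refine Finset.sum_le_sum fun T _ => ?_
    have hw : 0 ≤ (p : ℝ) ^ T.card * (1 - p : ℝ) ^ (Finset.univ \ T).card :=
      mul_nonneg (pow_nonneg p.2.1 _) (pow_nonneg (sub_nonneg.2 p.2.2) _)
    rw [mul_assoc]
    refine mul_le_mul_of_nonneg_left ?_ hw
    split_ifs with h
    · rw [one_mul]
      have hT : (T : Set (Fin n)).toFinite.toFinset = T :=
        Finset.coe_injective (Set.Finite.coe_toFinset _)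
      rw [Set.mem_ofPred_eq, hT] at h
      rw [smul_comm (p : ℝ), ← smul_sub, norm_smul, Real.norm_of_nonneg hc]
      have h2 : 2 * Λ ≤ lam / r * ‖∑ i ∈ T, v i - (p : ℝ) • ∑ i, v i‖ := by
        calc 2 * Λ = 2 * (lam * Real.sqrt (N * Λ)) := by rw [hl3]
          _ = lam / r * (2 * r * Real.sqrt (N * Λ)) := by field_simp
          _ ≤ _ := mul_le_mul_of_nonneg_left h.le hc
      calc Real.exp (2 * Λ) / 2
          ≤ Real.exp (lam / r * ‖∑ i ∈ T, v i - (p : ℝ) • ∑ i, v i‖) / 2 := by gcongr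
        _ ≤ _ := by
          rw [Real.cosh_eq]
          have := Real.exp_pos (-(lam / r * ‖∑ i ∈ T, v i - (p : ℝ) • ∑ i, v i‖))
          linarith
    · rw [zero_mul]; exact (Real.cosh_pos _).le
  have hE : Real.exp Λ = 2 * Real.exp (-Λ) * (Real.exp (2 * Λ) / 2) := by
    rw [show 2 * Real.exp (-Λ) * (Real.exp (2 * Λ) / 2) = Real.exp (-Λ) * Real.exp (2 * Λ) by ring,
      ← Real.exp_add]
    congr 1; ring
  rw [hE] at hmarkov
  exact le_of_mul_le_mul_right hmarkov (by positivity)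

end Concentration

noncomputable section

/-! ### Projections onto label classes and uniqueness of the block diagonal feasible matrix -/

section Labels

set_option linter.unusedSectionVars false

variable {ι κ : Type*} [Fintype ι] [DecidableEq ι] [DecidableEq κ]

/-- The number of indices with label `a`. -/
def labelCount (f : ι → κ) (a : κ) : ℕ := (Finset.univ.filter fun i => f i = a).card

/-- The projection onto the vectors that are constant on each label class. -/
def labelMatrix (f : ι → κ) : Matrix ι ι ℝ :=
  Matrix.of fun i j => if f j = f i then (labelCount f (f i) : ℝ)⁻¹ else 0

theorem labelCount_ne_zero (f : ι → κ) (i : ι) : (labelCount f (f i) : ℝ) ≠ 0 :=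
  Nat.cast_ne_zero.2 (Finset.card_ne_zero.2 ⟨i, by simp⟩)

theorem sum_labelMatrix_mul (f : ι → κ) (i : ι) (w : ι → ℝ) :
    ∑ j, labelMatrix f i j * w j =
      (labelCount f (f i) : ℝ)⁻¹ * ∑ j with f j = f i, w j := by
  simp [labelMatrix, Finset.sum_filter, Finset.mul_sum]

theorem labelMatrix_transpose (f : ι → κ) : (labelMatrix f).transpose = labelMatrix f := by
  ext i j
  simp only [Matrix.transpose_apply, labelMatrix, Matrix.of_apply]
  by_cases h : f i = f j
  · simp [h]
  · rw [if_neg h, if_neg (Ne.symm h)]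

theorem labelMatrix_mulVec_one (f : ι → κ) : Matrix.mulVec (labelMatrix f) 1 = 1 := by
  ext i
  have := sum_labelMatrix_mul f i 1
  simp only [Matrix.mulVec, dotProduct]
  rw [this]
  simpa only [labelCount, Pi.one_apply, Finset.sum_const, nsmul_eq_mul, mul_one] using
    inv_mul_cancel₀ (labelCount_ne_zero f i)

/-- Each row of `Z` is supported on one class and sums to one, so `Z` fixes vectors constant on
classes. -/
theorem mul_labelMatrix {f : ι → κ} {Z : Matrix ι ι ℝ} (h1 : Matrix.mulVec Z 1 = 1)
    (h0 : ∀ i j, f i ≠ f j → Z i j = 0) : Z * labelMatrix f = labelMatrix f := by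
  ext i l
  rw [Matrix.mul_apply]
  have : ∀ j, Z i j * labelMatrix f j l = Z i j * labelMatrix f i l := fun j => by
    by_cases h : f i = f j
    · simp [labelMatrix, h]
    · simp [h0 i j h]
  simp only [this, ← Finset.sum_mul]
  have h2 := congrFun h1 i
  simp only [Matrix.mulVec, dotProduct, Pi.one_apply, mul_one] at h2
  rw [h2, one_mul]

theorem labelMatrix_mul_self (f : ι → κ) : labelMatrix f * labelMatrix f = labelMatrix f :=
  mul_labelMatrix (labelMatrix_mulVec_one f) fun i j h => by simp [labelMatrix, Ne.symm h]

theorem labelMatrix_posSemidef (f : ι → κ) : (labelMatrix f).PosSemidef := by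
  have := Matrix.posSemidef_self_mul_conjTranspose (labelMatrix f)
  rwa [Matrix.conjTranspose_eq_transpose_of_trivial, labelMatrix_transpose,
    labelMatrix_mul_self] at this

theorem sum_label_eq [Fintype κ] {M : Type*} [AddCommMonoid M] (f : ι → κ) (g : ι → M) :
    ∑ i, g i = ∑ a, ∑ i with f i = a, g i :=
  (Finset.sum_fiberwise _ _ _).symm

theorem sum_inv_labelCount [Fintype κ] {f : ι → κ} (hf : Function.Surjective f) :
    ∑ i, (labelCount f (f i) : ℝ)⁻¹ = Fintype.card κ := by
  rw [sum_label_eq f]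
  have : ∀ a, ∑ i with f i = a, (labelCount f (f i) : ℝ)⁻¹ = 1 := fun a => by
    obtain ⟨i, rfl⟩ := hf a
    rw [Finset.sum_congr rfl (g := fun _ => (labelCount f (f i) : ℝ)⁻¹)
      fun j hj => by rw [(Finset.mem_filter.1 hj).2], Finset.sum_const, nsmul_eq_mul]
    exact mul_inv_cancel₀ (labelCount_ne_zero f i)
  simp [this]

theorem labelMatrix_trace [Fintype κ] {f : ι → κ} (hf : Function.Surjective f) :
    (labelMatrix f).trace = Fintype.card κ := by
  rw [← sum_inv_labelCount hf]
  simp [Matrix.trace, labelMatrix]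

/-- A feasible matrix supported on the diagonal blocks is the label matrix. -/
theorem eq_labelMatrix [Fintype κ] {f : ι → κ} (hf : Function.Surjective f) {Z : Matrix ι ι ℝ}
    (h1 : Matrix.mulVec Z 1 = 1) (htr : Z.trace = Fintype.card κ) (hZ : Z.PosSemidef)
    (h0 : ∀ i j, f i ≠ f j → Z i j = 0) : Z = labelMatrix f := by
  have hr := mul_labelMatrix h1 h0
  have hZt : Z.transpose = Z := by
    rw [← Matrix.conjTranspose_eq_transpose_of_trivial]; exact hZ.isHermitian
  have hl : labelMatrix f * Z = labelMatrix f := by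
    have := congrArg Matrix.transpose hr
    rwa [Matrix.transpose_mul, hZt, labelMatrix_transpose] at this
  -- Compressing `Z` by the complementary projection leaves `Z - labelMatrix f`, which is positive
  -- semidefinite with trace zero.
  have hps : (Z - labelMatrix f).PosSemidef := by
    have := hZ.mul_mul_conjTranspose_same (1 - labelMatrix f)
    rw [Matrix.conjTranspose_eq_transpose_of_trivial, Matrix.transpose_sub, Matrix.transpose_one,
      labelMatrix_transpose, sub_mul, one_mul, hl, mul_sub, mul_one, sub_mul, hr,
      labelMatrix_mul_self, sub_self, sub_zero] at this
    exact this
  refine sub_eq_zero.1 (hps.trace_eq_zero_iff.1 ?_)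
  rw [Matrix.trace_sub, htr, labelMatrix_trace hf, sub_self]

theorem sum_mul_nonneg_of_posSemidef {Z : Matrix ι ι ℝ} (hZ : Z.PosSemidef) {q : ι → ι → ℝ}
    (hq : ∀ w : ι → ℝ, 0 ≤ ∑ i, ∑ j, w i * w j * q i j) : 0 ≤ ∑ i, ∑ j, Z i j * q i j := by
  obtain ⟨m, v, rfl⟩ := Matrix.posSemidef_iff_eq_sum_vecMulVec.1 hZ
  have : ∑ i, ∑ j, (∑ l, Matrix.vecMulVec (v l) (star (v l))) i j * q i j =
      ∑ l, ∑ i, ∑ j, v l i * v l j * q i j := by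
    simp only [Matrix.sum_apply, Matrix.vecMulVec_apply, star_trivial,
      Finset.sum_mul]
    simp_rw [Finset.sum_comm (s := (Finset.univ : Finset ι)) (t := (Finset.univ : Finset (Fin m)))]
  rw [this]
  exact Finset.sum_nonneg fun l _ => hq _

end Labels

/-! ### The dual certificate -/

section Certificate

set_option linter.unusedSectionVars false

variable {E : Type*} [NormedAddCommGroup E] [InnerProductSpace ℝ E]

/-- The unit vector pointing from `v` to `u` (zero if `u = v`). -/
def direction (u v : E) : E := ‖u - v‖⁻¹ • (u - v)

theorem direction_self (u : E) : direction u u = 0 := by simp [direction]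

theorem direction_swap (u v : E) : direction v u = -direction u v := by
  rw [direction, direction, ← smul_neg, neg_sub, norm_sub_rev]

theorem norm_smul_direction (u v : E) : ‖u - v‖ • direction u v = u - v := by
  rcases eq_or_ne u v with rfl | h
  · simp
  · rw [direction, smul_inv_smul₀ (norm_ne_zero_iff.2 (sub_ne_zero.2 h))]

theorem norm_direction_of_ne {u v : E} (h : u ≠ v) : ‖direction u v‖ = 1 := by
  rw [direction, norm_smul, norm_inv, norm_norm,
    inv_mul_cancel₀ (norm_ne_zero_iff.2 (sub_ne_zero.2 h))]

theorem norm_direction_le (u v : E) : ‖direction u v‖ ≤ 1 := by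
  rcases eq_or_ne u v with rfl | h
  · simp [direction_self]
  · exact (norm_direction_of_ne h).le

/-- The left side pairs `p` with the reflection of `q` in the hyperplane orthogonal to `e`, an
isometry. The case `e = 0` covers equal centroids, in particular a cluster paired with itself. -/
theorem inner_reflection_le {e : E} (he : e = 0 ∨ ‖e‖ = 1) (p q : E) :
    inner ℝ p q - 2 * (inner ℝ p e * inner ℝ q e) ≤ ‖p‖ * ‖q‖ := by
  have h1 : inner ℝ p q - 2 * (inner ℝ p e * inner ℝ q e) =
      inner ℝ p (q - (2 * inner ℝ q e) • e) := by
    rw [inner_sub_right, inner_smul_right]; ring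
  have h2 : ‖q - (2 * inner ℝ q e) • e‖ = ‖q‖ := by
    rcases he with rfl | he
    · simp
    · rw [← sq_eq_sq₀ (norm_nonneg _) (norm_nonneg _), norm_sub_sq_real, inner_smul_right,
        norm_smul, he, mul_one, Real.norm_eq_abs, sq_abs]
      ring
  rw [h1, ← h2]
  exact real_inner_le_norm _ _

theorem direction_eq_zero_or (u v : E) : direction u v = 0 ∨ ‖direction u v‖ = 1 := by
  rcases eq_or_ne u v with rfl | h
  · exact .inl (direction_self _)
  · exact .inr (norm_direction_of_ne h)

variable {ι κ : Type*} [Fintype ι] [DecidableEq ι] [Fintype κ] [DecidableEq κ]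

/-- The quadratic form of the dual certificate is nonnegative. -/
theorem certificate_quadratic_nonneg (f : ι → κ) (y : ι → E) (c : κ → E)
    (hy : ∀ a, ∑ i with f i = a, y i = 0) (N : κ → ℝ) (hN0 : ∀ a, 0 ≤ N a)
    (hN : ∀ a (w : ι → ℝ), ‖∑ i with f i = a, w i • y i‖ ^ 2 ≤ N a * ∑ i with f i = a, w i ^ 2)
    (w : ι → ℝ) :
    0 ≤ ∑ i, ∑ j, w i * w j * (2 * (∑ a, N a) * ((if i = j then 1 else 0) - labelMatrix f i j) -
      2 * (inner ℝ (y i) (y j) - 2 * (inner ℝ (y i) (direction (c (f i)) (c (f j))) *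
        inner ℝ (y j) (direction (c (f i)) (c (f j)))))) := by
  set m : κ → ℝ := fun a => (labelCount f a : ℝ)⁻¹ * ∑ j with f j = a, w j with hm
  set u : ι → ℝ := fun i => w i - m (f i) with hu
  set P : κ → E := fun a => ∑ i with f i = a, w i • y i with hP
  -- Here `u` is `w` minus its class means. Since `y` sums to zero on each class, replacing `w` by
  -- `u` leaves every `P a` unchanged.
  have hu0 : ∀ a, ∑ i with f i = a, u i = 0 := fun a => by
    by_cases ha : ∃ i, f i = a
    · obtain ⟨i, rfl⟩ := ha
      simp only [hu, Finset.sum_sub_distrib]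
      rw [Finset.sum_congr rfl (g := fun _ => m (f i))
        (f := fun j => m (f j)) fun j hj => by rw [(Finset.mem_filter.1 hj).2], Finset.sum_const,
        nsmul_eq_mul, sub_eq_zero]
      exact (mul_inv_cancel_left₀ (labelCount_ne_zero f i) _).symm
    · push Not at ha
      rw [Finset.filter_false_of_mem fun i _ => ha i, Finset.sum_empty]
  have hPu : ∀ a, P a = ∑ i with f i = a, u i • y i := fun a => by
    simp only [hu, sub_smul, Finset.sum_sub_distrib]
    rw [Finset.sum_congr rfl (g := fun i => m a • y i) (f := fun i => m (f i) • y i)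
        fun j hj => by rw [(Finset.mem_filter.1 hj).2], ← Finset.smul_sum, hy, smul_zero, sub_zero]
  have hA : ∑ i, ∑ j, w i * w j * ((if i = j then 1 else 0) - labelMatrix f i j) =
      ∑ a, ∑ i with f i = a, u i ^ 2 := by
    have h1 : ∀ i, ∑ j, w i * w j * ((if i = j then 1 else 0) - labelMatrix f i j) =
        u i ^ 2 + m (f i) * u i := fun i => by
      have h2 := sum_labelMatrix_mul f i w
      calc _ = w i * (∑ j, (if i = j then w j else 0) - ∑ j, labelMatrix f i j * w j) := by
            rw [← Finset.sum_sub_distrib, Finset.mul_sum]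
            refine Finset.sum_congr rfl fun j _ => ?_
            split_ifs <;> ring
        _ = _ := by
            rw [h2, Finset.sum_ite_eq, if_pos (Finset.mem_univ _)]
            simp only [hu, hm]; ring
    simp only [h1, Finset.sum_add_distrib]
    rw [← sum_label_eq f (fun i => u i ^ 2), add_eq_left, sum_label_eq f]
    refine Finset.sum_eq_zero fun a _ => ?_
    rw [Finset.sum_congr rfl (g := fun i => m a * u i)
      fun j hj => by rw [(Finset.mem_filter.1 hj).2], ← Finset.mul_sum, hu0, mul_zero]
  have hB : ∑ i, ∑ j, w i * w j * (inner ℝ (y i) (y j) -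
        2 * (inner ℝ (y i) (direction (c (f i)) (c (f j))) *
          inner ℝ (y j) (direction (c (f i)) (c (f j))))) =
      ∑ a, ∑ b, (inner ℝ (P a) (P b) - 2 * (inner ℝ (P a) (direction (c a) (c b)) *
        inner ℝ (P b) (direction (c a) (c b)))) := by
    rw [sum_label_eq f]
    refine Finset.sum_congr rfl fun a _ => ?_
    have h1 : ∀ i ∈ Finset.univ.filter (fun i => f i = a), ∑ j, w i * w j * (inner ℝ (y i) (y j) -
        2 * (inner ℝ (y i) (direction (c (f i)) (c (f j))) *
          inner ℝ (y j) (direction (c (f i)) (c (f j))))) =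
        ∑ b, (inner ℝ (w i • y i) (P b) - 2 * (inner ℝ (w i • y i) (direction (c a) (c b)) *
          inner ℝ (P b) (direction (c a) (c b)))) := fun i hi => by
      rw [sum_label_eq f]
      refine Finset.sum_congr rfl fun b _ => ?_
      simp only [hP, inner_sum, sum_inner, Finset.mul_sum, ← Finset.sum_sub_distrib]
      refine Finset.sum_congr rfl fun j hj => ?_
      rw [(Finset.mem_filter.1 hi).2, (Finset.mem_filter.1 hj).2]
      simp only [inner_smul_left, inner_smul_right, RCLike.conj_to_real]
      ring
    rw [Finset.sum_congr rfl h1, Finset.sum_comm]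
    refine Finset.sum_congr rfl fun b _ => ?_
    rw [Finset.sum_sub_distrib, ← Finset.mul_sum, ← Finset.sum_mul, ← sum_inner, ← sum_inner]
  have hC : ∑ a, ∑ b, (inner ℝ (P a) (P b) - 2 * (inner ℝ (P a) (direction (c a) (c b)) *
        inner ℝ (P b) (direction (c a) (c b)))) ≤
      (∑ a, N a) * ∑ a, ∑ i with f i = a, u i ^ 2 := by
    -- The reflections vary with the pair of clusters, but bounding each by norms makes the double
    -- sum a perfect square, to which Cauchy–Schwarz applies.
    calc _ ≤ ∑ a, ∑ b, ‖P a‖ * ‖P b‖ := Finset.sum_le_sum fun a _ => Finset.sum_le_sum fun b _ =>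
          inner_reflection_le (direction_eq_zero_or _ _) _ _
      _ = (∑ a, ‖P a‖) ^ 2 := by rw [sq, Finset.sum_mul_sum]
      _ ≤ _ := Finset.sum_sq_le_sum_mul_sum_of_sq_le_mul _ (fun a _ => hN0 a)
          (fun a _ => Finset.sum_nonneg fun i _ => sq_nonneg _)
          (fun a _ => by rw [hPu]; exact hN a u)
  have hsplit : ∀ i j, w i * w j * (2 * (∑ a, N a) *
        ((if i = j then 1 else 0) - labelMatrix f i j) -
      2 * (inner ℝ (y i) (y j) - 2 * (inner ℝ (y i) (direction (c (f i)) (c (f j))) *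
        inner ℝ (y j) (direction (c (f i)) (c (f j)))))) =
      2 * (∑ a, N a) * (w i * w j * ((if i = j then 1 else 0) - labelMatrix f i j)) -
      2 * (w i * w j * (inner ℝ (y i) (y j) - 2 * (inner ℝ (y i) (direction (c (f i)) (c (f j))) *
        inner ℝ (y j) (direction (c (f i)) (c (f j)))))) := fun i j => by ring
  simp only [hsplit, Finset.sum_sub_distrib, ← Finset.mul_sum] at hA hB hC ⊢
  rw [hA, hB]
  linarith

/-- Both points are expanded relative to the bisector of `c` and `c'`. The free `t` cancels; it is
later chosen to match the correction in `B`. -/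
theorem norm_sub_sq_eq_certificate (y y' c c' : E) (t : ℝ) :
    ‖(y + c) - (y' + c')‖ ^ 2 =
      -2 * (inner ℝ y y' - 2 * (inner ℝ y (direction c c') * inner ℝ y' (direction c c'))) +
      (4 * (inner ℝ (y + c - (1 / 2 : ℝ) • (c + c')) (direction c c') *
        inner ℝ (y' + c' - (1 / 2 : ℝ) • (c' + c)) (direction c' c)) - t) +
      ‖y‖ ^ 2 + ‖y'‖ ^ 2 + t := by
  set e := direction c c' with he
  set l := ‖c - c'‖ with hl
  have h1 : c - c' = l • e := (norm_smul_direction c c').symm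
  have hle : l * inner ℝ e e = l := by
    rcases eq_or_ne c c' with h | h
    · simp [hl, h]
    · rw [real_inner_self_eq_norm_sq, norm_direction_of_ne h]; simp
  have h2 : y + c - (1 / 2 : ℝ) • (c + c') = y + (l / 2) • e := by
    rw [show (l / 2) • e = (1 / 2 : ℝ) • (l • e) by module, ← h1]; module
  have h3 : y' + c' - (1 / 2 : ℝ) • (c' + c) = y' - (l / 2) • e := by
    rw [show (l / 2) • e = (1 / 2 : ℝ) • (l • e) by module, ← h1]; module
  have h4 : y + c - (y' + c') = y - y' + l • e := by rw [← h1]; abel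
  have h5 : ‖l • e‖ ^ 2 = l ^ 2 := by
    rw [← real_inner_self_eq_norm_sq, inner_smul_left, inner_smul_right, hle]
    simp [sq]
  rw [h2, h3, h4, direction_swap c c', ← he, norm_add_sq_real, norm_sub_sq_real, h5]
  simp only [inner_add_left, inner_sub_left, inner_smul_left, inner_smul_right, inner_neg_right,
    RCLike.conj_to_real]
  linear_combination (-2 * inner ℝ y e + 2 * inner ℝ y' e - l * inner ℝ e e - l) * hle

/-- A dual certificate for the Peng--Wei program under the proximity condition. -/
theorem exists_dual_certificate (f : ι → κ) (hf : Function.Surjective f) (x : ι → E) (c : κ → E)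
    (hc : ∀ a, ∑ i with f i = a, (x i - c (f i)) = 0) (N : κ → ℝ) (hN0 : ∀ a, 0 ≤ N a)
    (hN : ∀ a (w : ι → ℝ), ‖∑ i with f i = a, w i • (x i - c (f i))‖ ^ 2 ≤
      N a * ∑ i with f i = a, w i ^ 2)
    (hprox : ∀ i b, f i ≠ b → 1 / 2 * Real.sqrt ((1 / (labelCount f (f i) : ℝ) +
      1 / (labelCount f b : ℝ)) * ∑ a, N a) <
        inner ℝ (x i - (1 / 2 : ℝ) • (c (f i) + c b)) (direction (c (f i)) (c b))) :
    ∃ B : ι → ι → ℝ, (∀ i j, f i = f j → B i j = 0) ∧ (∀ i j, f i ≠ f j → 0 < B i j) ∧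
      ∀ Z : Matrix ι ι ℝ, Matrix.mulVec Z 1 = 1 → Z.trace = Fintype.card κ → Z.PosSemidef →
        2 * ∑ i, ‖x i - c (f i)‖ ^ 2 + ∑ i, ∑ j, Z i j * B i j ≤
          ∑ i, ∑ j, Z i j * ‖x i - x j‖ ^ 2 := by
  set S : ℝ := ∑ a, N a with hS
  have hS0 : 0 ≤ S := Finset.sum_nonneg fun a _ => hN0 a
  set y : ι → E := fun i => x i - c (f i) with hy
  set α : ι → κ → ℝ := fun i b =>
    inner ℝ (x i - (1 / 2 : ℝ) • (c (f i) + c b)) (direction (c (f i)) (c b)) with hα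
  set h : κ → κ → ℝ := fun a b => 1 / (labelCount f a : ℝ) + 1 / (labelCount f b : ℝ) with hh
  have hh0 : ∀ a b, 0 ≤ h a b := fun a b => by positivity
  -- Across clusters, `B > 0` says that the product of the two bisector distances exceeds `hS/4`;
  -- proximity makes each factor exceed `½√(hS)`.
  refine ⟨fun i j => if f i = f j then 0 else 4 * (α i (f j) * α j (f i)) - h (f i) (f j) * S,
    fun i j hij => if_pos hij, fun i j hij => ?_, fun Z h1 htr hZ => ?_⟩
  · beta_reduce
    rw [if_neg hij, sub_pos]
    have k1 := hprox i (f j) hij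
    have k2 := hprox j (f i) (Ne.symm hij)
    rw [add_comm (1 / (labelCount f (f j) : ℝ))] at k2
    have k3 := Real.sq_sqrt (mul_nonneg (hh0 (f i) (f j)) hS0)
    have k4 := Real.sqrt_nonneg (h (f i) (f j) * S)
    have k5 := mul_lt_mul'' k1 k2 (by positivity) (by positivity)
    nlinarith
  set q : ι → ι → ℝ := fun i j => 2 * S * ((if i = j then 1 else 0) - labelMatrix f i j) -
      2 * (inner ℝ (y i) (y j) - 2 * (inner ℝ (y i) (direction (c (f i)) (c (f j))) *
        inner ℝ (y j) (direction (c (f i)) (c (f j))))) with hq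
  have hq0 : 0 ≤ ∑ i, ∑ j, Z i j * q i j := sum_mul_nonneg_of_posSemidef hZ
    (certificate_quadratic_nonneg f y c hc N hN0 hN)
  -- The `S/|class|` part cancels `-2S · labelMatrix` within a class and `-hS` across classes. Its
  -- total is cancelled in turn by the trace term `2Sk`.
  set μ : ι → ℝ := fun i => ‖y i‖ ^ 2 + S * (labelCount f (f i) : ℝ)⁻¹ with hμ
  have hD : ∀ i j, ‖x i - x j‖ ^ 2 = q i j +
      (if f i = f j then 0 else 4 * (α i (f j) * α j (f i)) - h (f i) (f j) * S) + μ i + μ j -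
      2 * S * (if i = j then 1 else 0) := fun i j => by
    by_cases hij : f i = f j
    · have : x i - x j = y i - y j := by simp only [hy, hij]; abel
      rw [if_pos hij, this, norm_sub_sq_real]
      simp only [hq, hμ, labelMatrix, Matrix.of_apply, hij, direction_self, inner_zero_right,
        if_true]
      ring
    · have hne : i ≠ j := fun h => hij (h ▸ rfl)
      have := norm_sub_sq_eq_certificate (y i) (y j) (c (f i)) (c (f j)) (h (f i) (f j) * S)
      have e1 : ∀ i, y i + c (f i) = x i := fun i => sub_add_cancel _ _
      rw [e1, e1] at this
      rw [this, if_neg hij]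
      simp only [hq, hμ, labelMatrix, Matrix.of_apply, if_neg (Ne.symm hij), if_neg hne, hα, hh]
      ring
  have hrow : ∀ i, ∑ j, Z i j = 1 := fun i => by
    simpa [Matrix.mulVec, dotProduct] using congrFun h1 i
  have hcol : ∀ j, ∑ i, Z i j = 1 := fun j => by
    rw [← hrow j]
    refine Finset.sum_congr rfl fun i _ => ?_
    simpa using hZ.isHermitian.apply j i
  have t1 : ∑ i, ∑ j, Z i j * μ i = ∑ i, μ i := by
    simp only [← Finset.sum_mul, hrow, one_mul]
  have t2 : ∑ i, ∑ j, Z i j * μ j = ∑ i, μ i := by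
    rw [Finset.sum_comm]; simp only [← Finset.sum_mul, hcol, one_mul]
  have t3 : ∑ i, ∑ j, Z i j * (2 * S * (if i = j then 1 else 0)) = 2 * S * Fintype.card κ := by
    have : ∀ i, ∑ j, Z i j * (2 * S * (if i = j then 1 else 0)) = 2 * S * Z i i := fun i => by
      simp [mul_comm]
    simp only [this, ← Finset.mul_sum, ← htr, Matrix.trace, Matrix.diag_apply]
  have t4 : ∑ i, μ i = ∑ i, ‖y i‖ ^ 2 + S * Fintype.card κ := by
    rw [← sum_inv_labelCount hf, Finset.mul_sum, ← Finset.sum_add_distrib]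
  simp only [hD, mul_add, mul_sub, Finset.sum_add_distrib, Finset.sum_sub_distrib] at t1 t2 t3 ⊢
  rw [t1, t2, t3, t4]
  linarith

/-- Shows that the planted projection attains the certificate's lower bound: within a class the
cross terms average to zero. -/
theorem sum_labelMatrix_mul_dist (f : ι → κ) (x : ι → E) (c : κ → E)
    (hc : ∀ a, ∑ i with f i = a, (x i - c (f i)) = 0) :
    ∑ i, ∑ j, labelMatrix f i j * ‖x i - x j‖ ^ 2 = 2 * ∑ i, ‖x i - c (f i)‖ ^ 2 := by
  set y : ι → E := fun i => x i - c (f i) with hy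
  have hrow : ∀ i, ∑ j, labelMatrix f i j = 1 := fun i => by
    simpa [Matrix.mulVec, dotProduct] using congrFun (labelMatrix_mulVec_one f) i
  have hcol : ∀ j, ∑ i, labelMatrix f i j = 1 := fun j => by
    rw [← hrow j]
    exact Finset.sum_congr rfl fun i _ => congrFun (congrFun (labelMatrix_transpose f) j) i
  have hD : ∀ i j, labelMatrix f i j * ‖x i - x j‖ ^ 2 = labelMatrix f i j * ‖y i‖ ^ 2 +
      labelMatrix f i j * ‖y j‖ ^ 2 - 2 * (labelMatrix f i j * inner ℝ (y j) (y i)) :=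
    fun i j => by
    by_cases hij : f j = f i
    · have : x i - x j = y i - y j := by simp only [hy, hij]; abel
      rw [this, norm_sub_sq_real, real_inner_comm]; ring
    · simp [labelMatrix, hij]
  have h0 : ∀ i, ∑ j, labelMatrix f i j * inner ℝ (y j) (y i) = 0 := fun i => by
    rw [sum_labelMatrix_mul, ← sum_inner, hc, inner_zero_left, mul_zero]
  simp only [hD, Finset.sum_add_distrib, Finset.sum_sub_distrib, ← Finset.mul_sum, h0]
  rw [Finset.sum_comm (f := fun i j => labelMatrix f i j * ‖y j‖ ^ 2)]
  simp only [← Finset.sum_mul, hrow, hcol, one_mul, Finset.sum_const_zero]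
  ring

end Certificate

/-! ### Exact recovery from proximity on the sketch -/

section Program

variable {n d : ℕ}

theorem trace_sqDistMatrix_mul (X : Fin n → EuclideanSpace ℝ (Fin d)) (W : Finset (Fin n))
    (Z : Matrix W W ℝ) :
    (sqDistMatrix X W * Z).trace = ∑ i : W, ∑ j : W, Z i j * ‖X i - X j‖ ^ 2 := by
  simp only [Matrix.trace, Matrix.diag_apply, Matrix.mul_apply, sqDistMatrix, Matrix.of_apply]
  rw [Finset.sum_comm]
  refine Finset.sum_congr rfl fun i _ => Finset.sum_congr rfl fun j _ => ?_
  rw [norm_sub_rev, mul_comm]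

/-- Twice the inner product with `c - c'` is the difference of squared distances to `c'` and `c`. -/
theorem norm_sub_lt_of_inner_direction_pos {E : Type*} [NormedAddCommGroup E]
    [InnerProductSpace ℝ E] {x c c' : E}
    (h : 0 < inner ℝ (x - (1 / 2 : ℝ) • (c + c')) (direction c c')) : ‖x - c‖ < ‖x - c'‖ := by
  have hne : c ≠ c' := by
    rintro rfl
    simp [direction_self] at h
  have h1 : 0 < inner ℝ (x - (1 / 2 : ℝ) • (c + c')) (c - c') := by
    rw [← norm_smul_direction c c', inner_smul_right]
    exact mul_pos (norm_pos_iff.2 (sub_ne_zero.2 hne)) h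
  have h2 : ‖x - c'‖ ^ 2 - ‖x - c‖ ^ 2 = 2 * inner ℝ (x - (1 / 2 : ℝ) • (c + c')) (c - c') := by
    have e1 : x - c' = x - (1 / 2 : ℝ) • (c + c') + (1 / 2 : ℝ) • (c - c') := by module
    have e2 : x - c = x - (1 / 2 : ℝ) • (c + c') - (1 / 2 : ℝ) • (c - c') := by module
    rw [e1, e2, norm_add_sq_real, norm_sub_sq_real (x - _), inner_smul_right]
    ring
  refine lt_of_pow_lt_pow_left₀ 2 (norm_nonneg _) ?_
  linarith

variable (Γ : Finpartition (Finset.univ : Finset (Fin n)))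

/-- The label of a sketched index is the cluster that contains it. -/
def clusterLabel (W : Finset (Fin n)) (i : W) : {S // S ∈ Γ.parts} :=
  ⟨Γ.part i, Γ.part_mem.2 (Finset.mem_univ _)⟩

theorem sum_clusterLabel_eq (W : Finset (Fin n)) (a : {S // S ∈ Γ.parts}) {M : Type*}
    [AddCommMonoid M] (g : Fin n → M) :
    ∑ i : W with clusterLabel Γ W i = a, g i = ∑ i ∈ a.1 ∩ W, g i := by
  rw [Finset.sum_filter]
  simp only [clusterLabel, Subtype.ext_iff, Γ.part_eq_iff_mem a.2]
  rw [Finset.sum_coe_sort W (fun i => if i ∈ a.1 then g i else 0), ← Finset.sum_filter,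
    Finset.filter_mem_eq_inter, Finset.inter_comm]

theorem labelCount_clusterLabel (W : Finset (Fin n)) (a : {S // S ∈ Γ.parts}) :
    labelCount (clusterLabel Γ W) a = (a.1 ∩ W).card := by
  rw [labelCount, Finset.card_eq_sum_ones, Finset.card_eq_sum_ones,
    sum_clusterLabel_eq Γ W a (fun _ => 1)]

variable {Γ} {W : Finset (Fin n)}

theorem restrict_parts_eq (hW : ∀ S ∈ Γ.parts, (S ∩ W).Nonempty) :
    (Γ.restrict (Finset.subset_univ W)).parts = Γ.parts.image (· ∩ W) := by
  simp only [Finpartition.restrict]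
  refine Finset.erase_eq_of_notMem fun h => ?_
  obtain ⟨S, hS, hS'⟩ := Finset.mem_image.1 h
  exact (hW S hS).ne_empty hS'

theorem inter_injOn (hW : ∀ S ∈ Γ.parts, (S ∩ W).Nonempty) :
    Set.InjOn (· ∩ W) (Γ.parts : Set (Finset (Fin n))) := by
  intro S hS T hT hST
  obtain ⟨i, hi⟩ := hW S hS
  have hi' : i ∈ T ∩ W := by simpa only [← hST] using hi
  exact Γ.eq_of_mem_parts hS hT (Finset.mem_inter.1 hi).1 (Finset.mem_inter.1 hi').1

theorem clusterMatrix_restrict :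
    clusterMatrix (Γ.restrict (Finset.subset_univ W)) = labelMatrix (clusterLabel Γ W) := by
  ext i j
  simp only [clusterMatrix, Matrix.sum_apply, Matrix.smul_apply, Matrix.vecMulVec_apply,
    smul_eq_mul]
  rw [Γ.sum_restrict (Finset.subset_univ W)
    (fun S => (S.card : ℝ)⁻¹ * ((if (i : Fin n) ∈ S then 1 else 0) *
      (if (j : Fin n) ∈ S then 1 else 0))) (by simp),
    Finset.sum_eq_single_of_mem _ (clusterLabel Γ W i).2]
  · have hi : (i : Fin n) ∈ (clusterLabel Γ W i).1 := Γ.mem_part (Finset.mem_univ _)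
    have hj : (j : Fin n) ∈ (clusterLabel Γ W i).1 ↔ clusterLabel Γ W j = clusterLabel Γ W i := by
      rw [Subtype.ext_iff, ← Γ.part_eq_iff_mem (clusterLabel Γ W i).2]; rfl
    simp [labelMatrix, labelCount_clusterLabel, hi, hj]
  · intro S hS hne
    have : (i : Fin n) ∉ S := fun h => hne ((Γ.part_eq_iff_mem hS).2 h).symm
    simp [this]

theorem sum_sub_centroid (X : Fin n → EuclideanSpace ℝ (Fin d)) (S : Finset (Fin n)) :
    ∑ i ∈ S, (X i - centroid X S) = 0 := by
  rcases S.eq_empty_or_nonempty with rfl | h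
  · simp
  · rw [Finset.sum_sub_distrib, Finset.sum_const, centroid, ← Nat.cast_smul_eq_nsmul ℝ,
      smul_inv_smul₀ (Nat.cast_ne_zero.2 h.card_pos.ne'), sub_self]

/-- If the sketch of every cluster is nonempty and satisfies the proximity condition, with all
points of `X` on the correct side of the sketched bisectors, then `Γ` is exactly recovered. -/
theorem exactlyRecovers_of_proximity {X : Fin n → EuclideanSpace ℝ (Fin d)} (hWne : W.Nonempty)
    (hW : ∀ S ∈ Γ.parts, (S ∩ W).Nonempty) (N : Finset (Fin n) → ℝ)
    (hN0 : ∀ S ∈ Γ.parts, 0 ≤ N S)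
    (hN : ∀ S ∈ Γ.parts, ∀ w : Fin n → ℝ,
      ‖∑ i ∈ S ∩ W, w i • (X i - centroid X (S ∩ W))‖ ^ 2 ≤ N S * ∑ i ∈ S ∩ W, w i ^ 2)
    (hprox : ∀ S ∈ Γ.parts, ∀ T ∈ Γ.parts, S ≠ T → ∀ i ∈ S,
      1 / 2 * Real.sqrt ((1 / ((S ∩ W).card : ℝ) + 1 / ((T ∩ W).card : ℝ)) *
        ∑ R ∈ Γ.parts, N R) <
      inner ℝ (X i - (1 / 2 : ℝ) • (centroid X (S ∩ W) + centroid X (T ∩ W)))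
        (direction (centroid X (S ∩ W)) (centroid X (T ∩ W)))) :
    ExactlyRecovers X Γ.parts.card W Γ := by
  classical
  set f := clusterLabel Γ W with hf
  have hsurj : Function.Surjective f := fun a => by
    obtain ⟨i, hi⟩ := hW a.1 a.2
    refine ⟨⟨i, (Finset.mem_inter.1 hi).2⟩, Subtype.ext ?_⟩
    exact (Γ.part_eq_iff_mem a.2).2 (Finset.mem_inter.1 hi).1
  have hcard : Fintype.card {S // S ∈ Γ.parts} = Γ.parts.card := Fintype.card_coe _
  set c : {S // S ∈ Γ.parts} → EuclideanSpace ℝ (Fin d) := fun a => centroid X (a.1 ∩ W) with hc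
  have hc0 : ∀ a, ∑ i : W with f i = a, (X i - c (f i)) = 0 := fun a => by
    rw [Finset.sum_congr rfl (g := fun i : W => X i - c a)
      fun j hj => by rw [(Finset.mem_filter.1 hj).2],
      sum_clusterLabel_eq Γ W a (fun i => X i - c a)]
    exact sum_sub_centroid X _
  obtain ⟨B, hB0, hBpos, hB⟩ := exists_dual_certificate f hsurj (fun i : W => X i) c hc0
    (fun a => N a.1) (fun a => hN0 a.1 a.2) (fun a w => by
      obtain ⟨w', hw'⟩ : ∃ w' : Fin n → ℝ, ∀ i : W, w i = w' i :=
        ⟨fun i => if h : i ∈ W then w ⟨i, h⟩ else 0, fun i => by simp⟩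
      rw [Finset.sum_congr rfl (g := fun i : W => w' i • (X i - c a))
        fun j hj => by rw [(Finset.mem_filter.1 hj).2, hw'],
        sum_clusterLabel_eq Γ W a (fun i => w' i • (X i - c a)),
        Finset.sum_congr rfl (g := fun i : W => w' i ^ 2) fun j _ => by rw [hw'],
        sum_clusterLabel_eq Γ W a (fun i => w' i ^ 2)]
      exact hN a.1 a.2 w')
    (fun i b hib => by
      have h := hprox (f i).1 (f i).2 b.1 b.2 (fun h => hib (Subtype.ext h)) i
        (Γ.mem_part (Finset.mem_univ _))
      rw [labelCount_clusterLabel, labelCount_clusterLabel, Finset.sum_coe_sort Γ.parts N]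
      exact h)
  have hcoef : 0 < 1 / (2 * (W.card : ℝ)) := by
    have := hWne.card_pos
    positivity
  have hobj : ∀ Z : Matrix W W ℝ, pengWeiObjective X W Z =
      1 / (2 * (W.card : ℝ)) * ∑ i : W, ∑ j : W, Z i j * ‖X i - X j‖ ^ 2 := fun Z => by
    rw [pengWeiObjective, trace_sqDistMatrix_mul]
  have hopt := sum_labelMatrix_mul_dist f (fun i : W => X i) c hc0
  have hBn : ∀ i j, 0 ≤ B i j := fun i j => by
    by_cases h : f i = f j
    · exact (hB0 i j h).ge
    · exact (hBpos i j h).le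
  have hfeas : labelMatrix f ∈ pengWeiFeasible W Γ.parts.card := by
    refine ⟨labelMatrix_mulVec_one f, by rw [labelMatrix_trace hsurj, hcard], fun i j => ?_,
      labelMatrix_posSemidef f⟩
    simp only [labelMatrix, Matrix.of_apply]
    split_ifs <;> positivity
  have hlower : ∀ Z ∈ pengWeiFeasible W Γ.parts.card,
      2 * ∑ i : W, ‖X i - c (f i)‖ ^ 2 + ∑ i, ∑ j, Z i j * B i j ≤
        ∑ i : W, ∑ j : W, Z i j * ‖X i - X j‖ ^ 2 := fun Z hZ =>
    hB Z hZ.1 (by rw [hcard]; exact hZ.2.1) hZ.2.2.2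
  have hBZ : ∀ Z ∈ pengWeiFeasible W Γ.parts.card, ∀ i j, 0 ≤ Z i j * B i j := fun Z hZ i j =>
    mul_nonneg (hZ.2.2.1 i j) (hBn i j)
  refine ⟨⟨labelMatrix f, hfeas, fun Z hZ => ?_⟩, fun Z hZ => ?_⟩
  · rw [hobj, hobj, hopt]
    refine mul_le_mul_of_nonneg_left ?_ hcoef.le
    have h1 := hlower Z hZ
    have h2 : 0 ≤ ∑ i, ∑ j, Z i j * B i j :=
      Finset.sum_nonneg fun i _ => Finset.sum_nonneg fun j _ => hBZ Z hZ i j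
    linarith
  have hle := hZ.2 _ hfeas
  rw [hobj, hobj, hopt] at hle
  have h1 := le_of_mul_le_mul_left hle hcoef
  have h2 := hlower Z hZ.1
  -- Complementary slackness: an optimal `Z` cannot pay anything for `B`, so it vanishes wherever
  -- `B` is positive.
  have h3 : ∑ i, ∑ j, Z i j * B i j = 0 :=
    le_antisymm (by linarith)
      (Finset.sum_nonneg fun i _ => Finset.sum_nonneg fun j _ => hBZ Z hZ.1 i j)
  have h4 : ∀ i j, Z i j * B i j = 0 := fun i j => by
    have h5 := (Finset.sum_eq_zero_iff_of_nonneg fun i _ =>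
      Finset.sum_nonneg fun j _ => hBZ Z hZ.1 i j).1 h3 i (Finset.mem_univ _)
    exact (Finset.sum_eq_zero_iff_of_nonneg fun j _ => hBZ Z hZ.1 i j).1 h5 j (Finset.mem_univ _)
  refine ⟨Γ.restrict (Finset.subset_univ W), ?_, ?_, fun σ hσ => ?_⟩
  · rw [restrict_parts_eq hW, Finset.card_image_of_injOn (inter_injOn hW)]
  · rw [clusterMatrix_restrict]
    exact eq_labelMatrix hsurj hZ.1.1 (by rw [hcard]; exact hZ.1.2.1) hZ.1.2.2.2
      fun i j hij => (mul_eq_zero.1 (h4 i j)).resolve_right (hBpos i j hij).ne'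
  -- Proximity is assumed for all of each cluster, not only its sketched points, so the nearest
  -- centroid is unique and no ties occur.
  have hσ' : ∀ i, σ i = Γ.part i ∩ W := fun i => by
    obtain ⟨hmem, hmin⟩ := hσ i
    rw [restrict_parts_eq hW] at hmem hmin
    obtain ⟨T, hT, hTσ⟩ := Finset.mem_image.1 hmem
    rw [← hTσ]
    by_contra hne
    have hpm : Γ.part i ∈ Γ.parts := Γ.part_mem.2 (Finset.mem_univ _)
    have hpos := hprox (Γ.part i) hpm T hT (fun h => hne (by rw [h])) i
      (Γ.mem_part (Finset.mem_univ _))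
    have hlt := norm_sub_lt_of_inner_direction_pos (lt_of_le_of_lt (by positivity) hpos)
    have := hmin _ (Finset.mem_image_of_mem (· ∩ W) hpm)
    rw [← hTσ] at this
    exact absurd this (not_le.2 hlt)
  rw [outputClusters, restrict_parts_eq hW, Finset.image_image]
  have hid : ∀ S ∈ Γ.parts, Finset.univ.filter (fun i => σ i = S ∩ W) = S := fun S hS => by
    ext i
    simp only [Finset.mem_filter, Finset.mem_univ, true_and, hσ']
    rw [← Γ.part_eq_iff_mem hS]
    exact ⟨fun h => inter_injOn hW (Γ.part_mem.2 (Finset.mem_univ _)) hS h, fun h => by rw [h]⟩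
  calc _ = Γ.parts.image id := Finset.image_congr fun S hS => hid S hS
    _ = Γ.parts := Finset.image_id

end Program

/-! ### Stability of the proximity condition under sampling -/

section Perturbation

theorem sqrt_add_le_add_sqrt {a b : ℝ} (ha : 0 ≤ a) (hb : 0 ≤ b) :
    Real.sqrt (a + b) ≤ Real.sqrt a + Real.sqrt b := by
  refine Real.sqrt_le_iff.2 ⟨by positivity, ?_⟩
  nlinarith [Real.sq_sqrt ha, Real.sq_sqrt hb, Real.sqrt_nonneg a, Real.sqrt_nonneg b,
    mul_nonneg (Real.sqrt_nonneg a) (Real.sqrt_nonneg b)]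

variable {E : Type*} [NormedAddCommGroup E] [InnerProductSpace ℝ E]

/-- After multiplying by `‖c - c'‖`, the error splits into a change of length and a change of
difference vector, each at most `2η`. -/
theorem norm_direction_sub_le {c c' C C' : E} {η : ℝ} (hne : c ≠ c') (h : ‖C - c‖ ≤ η)
    (h' : ‖C' - c'‖ ≤ η) : ‖direction C C' - direction c c'‖ ≤ 4 * η / ‖c - c'‖ := by
  have hl : 0 < ‖c - c'‖ := norm_pos_iff.2 (sub_ne_zero.2 hne)
  have hD : ‖(C - C') - (c - c')‖ ≤ 2 * η := by
    rw [show (C - C') - (c - c') = (C - c) - (C' - c') by abel]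
    linarith [norm_sub_le (C - c) (C' - c')]
  rw [le_div_iff₀ hl]
  have h1 : ‖c - c'‖ • (direction C C' - direction c c') =
      (‖c - c'‖ - ‖C - C'‖) • direction C C' + ((C - C') - (c - c')) := by
    rw [smul_sub, norm_smul_direction, sub_smul, norm_smul_direction]; abel
  calc _ = ‖‖c - c'‖ • (direction C C' - direction c c')‖ := by
        rw [norm_smul, norm_norm, mul_comm]
    _ ≤ |‖c - c'‖ - ‖C - C'‖| * 1 + 2 * η := by
        rw [h1]
        refine (norm_add_le _ _).trans (add_le_add ?_ hD)
        rw [norm_smul, Real.norm_eq_abs]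
        exact mul_le_mul_of_nonneg_left (norm_direction_le _ _) (abs_nonneg _)
    _ ≤ 4 * η := by
        have := (abs_norm_sub_norm_le (c - c') (C - C')).trans
          ((norm_sub_rev _ _).trans_le hD)
        linarith

/-- Moving the midpoint costs at most `η`. Rotating the direction costs at most `(r + ‖c - c'‖/2) ·
4η/‖c - c'‖`. -/
theorem inner_direction_perturb {x c c' C C' : E} {η r : ℝ} (hne : c ≠ c') (hx : ‖x - c‖ ≤ r)
    (h : ‖C - c‖ ≤ η) (h' : ‖C' - c'‖ ≤ η) :
    inner ℝ (x - (1 / 2 : ℝ) • (c + c')) (direction c c') - η * (3 + 4 * r / ‖c - c'‖) ≤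
      inner ℝ (x - (1 / 2 : ℝ) • (C + C')) (direction C C') := by
  have hl : 0 < ‖c - c'‖ := norm_pos_iff.2 (sub_ne_zero.2 hne)
  have hη : 0 ≤ η := (norm_nonneg _).trans h
  have hsplit : inner ℝ (x - (1 / 2 : ℝ) • (C + C')) (direction C C') =
      inner ℝ (x - (1 / 2 : ℝ) • (c + c')) (direction c c') -
      inner ℝ ((1 / 2 : ℝ) • ((C - c) + (C' - c'))) (direction C C') +
      inner ℝ (x - (1 / 2 : ℝ) • (c + c')) (direction C C' - direction c c') := by
    rw [inner_sub_right, show x - (1 / 2 : ℝ) • (C + C') =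
      x - (1 / 2 : ℝ) • (c + c') - (1 / 2 : ℝ) • ((C - c) + (C' - c')) by module,
      inner_sub_left (x - (1 / 2 : ℝ) • (c + c'))]
    ring
  have b1 : inner ℝ ((1 / 2 : ℝ) • ((C - c) + (C' - c'))) (direction C C') ≤ η := by
    refine (real_inner_le_norm _ _).trans ?_
    calc _ ≤ ‖(1 / 2 : ℝ) • ((C - c) + (C' - c'))‖ * 1 := by
          gcongr; exact norm_direction_le _ _
      _ ≤ η := by
          rw [norm_smul, Real.norm_of_nonneg (by norm_num)]
          linarith [norm_add_le (C - c) (C' - c')]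
  have b2 : |inner ℝ (x - (1 / 2 : ℝ) • (c + c')) (direction C C' - direction c c')| ≤
      η * (2 + 4 * r / ‖c - c'‖) := by
    refine (abs_real_inner_le_norm _ _).trans ?_
    have h1 : ‖x - (1 / 2 : ℝ) • (c + c')‖ ≤ r + ‖c - c'‖ / 2 := by
      rw [show x - (1 / 2 : ℝ) • (c + c') = (x - c) + (1 / 2 : ℝ) • (c - c') by module]
      refine (norm_add_le _ _).trans ?_
      rw [norm_smul, Real.norm_of_nonneg (by norm_num)]
      linarith
    calc _ ≤ (r + ‖c - c'‖ / 2) * (4 * η / ‖c - c'‖) :=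
          mul_le_mul h1 (norm_direction_sub_le hne h h') (norm_nonneg _)
            ((norm_nonneg _).trans h1)
      _ = _ := by field_simp; ring
  have := (abs_le.1 b2).1
  rw [hsplit]
  linarith

/-- A linear map and its adjoint have the same operator norm: pair the sum with itself and apply
Cauchy–Schwarz. -/
theorem norm_sum_smul_sq_le {ι : Type*} {S : Finset ι} {y : ι → E} {N : ℝ} (hN0 : 0 ≤ N)
    (h : ∀ u, ∑ i ∈ S, inner ℝ (y i) u ^ 2 ≤ N * ‖u‖ ^ 2) (w : ι → ℝ) :
    ‖∑ i ∈ S, w i • y i‖ ^ 2 ≤ N * ∑ i ∈ S, w i ^ 2 := by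
  set P := ∑ i ∈ S, w i • y i with hP
  have hw : 0 ≤ ∑ i ∈ S, w i ^ 2 := Finset.sum_nonneg fun i _ => sq_nonneg _
  have h1 : ‖P‖ ^ 2 = ∑ i ∈ S, w i * inner ℝ (y i) P := by
    rw [← real_inner_self_eq_norm_sq]
    conv_lhs => rw [hP, sum_inner]
    exact Finset.sum_congr rfl fun i _ => by rw [← hP, real_inner_smul_left]
  have h2 : (‖P‖ ^ 2) ^ 2 ≤ (∑ i ∈ S, w i ^ 2) * (N * ‖P‖ ^ 2) := by
    conv_lhs => rw [h1]
    exact (Finset.sum_mul_sq_le_sq_mul_sq _ _ _).trans (mul_le_mul_of_nonneg_left (h P) hw)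
  rcases (sq_nonneg ‖P‖).eq_or_lt with h0 | h0
  · rw [← h0]; positivity
  · nlinarith

/-- Recentering at the mean does not increase the operator norm: the weights may be replaced by
their mean-zero part, which has smaller norm. -/
theorem norm_sum_smul_sub_sq_le {ι : Type*} {S : Finset ι} {x : ι → E} {c c' : E} {N : ℝ}
    (hN0 : 0 ≤ N) (hc : ∑ i ∈ S, (x i - c') = 0)
    (h : ∀ w : ι → ℝ, ‖∑ i ∈ S, w i • (x i - c)‖ ^ 2 ≤ N * ∑ i ∈ S, w i ^ 2) (w : ι → ℝ) :
    ‖∑ i ∈ S, w i • (x i - c')‖ ^ 2 ≤ N * ∑ i ∈ S, w i ^ 2 := by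
  rcases S.eq_empty_or_nonempty with rfl | hS
  · simp
  set m : ℝ := (S.card : ℝ)⁻¹ * ∑ i ∈ S, w i with hm
  have hS0 : (S.card : ℝ) ≠ 0 := Nat.cast_ne_zero.2 hS.card_pos.ne'
  have hm0 : ∑ i ∈ S, (w i - m) = 0 := by
    rw [Finset.sum_sub_distrib, Finset.sum_const, nsmul_eq_mul, hm, mul_inv_cancel_left₀ hS0,
      sub_self]
  have e1 : ∑ i ∈ S, w i • (x i - c') = ∑ i ∈ S, (w i - m) • (x i - c) := by
    have : ∀ i, (w i - m) • (x i - c) =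
        w i • (x i - c') - m • (x i - c') + (w i - m) • (c' - c) := fun i => by module
    simp only [this, Finset.sum_add_distrib, Finset.sum_sub_distrib, ← Finset.smul_sum, hc]
    rw [← Finset.sum_smul, hm0]
    simp
  rw [e1]
  refine (h _).trans (mul_le_mul_of_nonneg_left ?_ hN0)
  have e2 : ∑ i ∈ S, (w i - m) ^ 2 = ∑ i ∈ S, w i ^ 2 - m ^ 2 * S.card := by
    have : ∀ i, (w i - m) ^ 2 = w i ^ 2 - 2 * m * (w i - m) - m ^ 2 := fun i => by ring
    simp only [this, Finset.sum_sub_distrib, ← Finset.mul_sum]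
    rw [← Finset.sum_sub_distrib, hm0, Finset.sum_const, nsmul_eq_mul]; ring
  rw [e2]
  have : 0 ≤ m ^ 2 * (S.card : ℝ) := by positivity
  linarith

variable {n d : ℕ}

/-- The rank-one matrix `y yᵀ`, as a vector with the Frobenius norm. -/
def outerSelf (y : EuclideanSpace ℝ (Fin d)) : EuclideanSpace ℝ (Fin d × Fin d) :=
  WithLp.toLp 2 fun a => y a.1 * y a.2

theorem inner_outerSelf (y z : EuclideanSpace ℝ (Fin d)) :
    inner ℝ (outerSelf y) (outerSelf z) = inner ℝ y z ^ 2 := by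
  simp only [outerSelf, PiLp.inner_apply, sq, RCLike.inner_apply, conj_trivial]
  rw [Finset.sum_mul_sum, Fintype.sum_prod_type]
  exact Finset.sum_congr rfl fun i _ => Finset.sum_congr rfl fun j _ => by ring

theorem norm_outerSelf (y : EuclideanSpace ℝ (Fin d)) : ‖outerSelf y‖ = ‖y‖ ^ 2 := by
  rw [← sq_eq_sq₀ (norm_nonneg _) (by positivity), ← real_inner_self_eq_norm_sq, inner_outerSelf,
    real_inner_self_eq_norm_sq]

/-- Pairing with `outerSelf u` turns a Frobenius deviation of second moments into a bound on
quadratic forms. -/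
theorem sum_inner_sq_le_of_outer_deviation {ι : Type*} {S S' : Finset ι}
    {y : ι → EuclideanSpace ℝ (Fin d)} {p t : ℝ}
    (h : ‖∑ i ∈ S', outerSelf (y i) - p • ∑ i ∈ S, outerSelf (y i)‖ ≤ t)
    (u : EuclideanSpace ℝ (Fin d)) :
    ∑ i ∈ S', inner ℝ (y i) u ^ 2 ≤ p * ∑ i ∈ S, inner ℝ (y i) u ^ 2 + t * ‖u‖ ^ 2 := by
  have h1 : ∑ i ∈ S', inner ℝ (y i) u ^ 2 - p * ∑ i ∈ S, inner ℝ (y i) u ^ 2 =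
      inner ℝ (∑ i ∈ S', outerSelf (y i) - p • ∑ i ∈ S, outerSelf (y i)) (outerSelf u) := by
    rw [inner_sub_left, real_inner_smul_left, sum_inner, sum_inner]
    simp only [inner_outerSelf]
  have h2 := real_inner_le_norm (∑ i ∈ S', outerSelf (y i) - p • ∑ i ∈ S, outerSelf (y i))
    (outerSelf u)
  rw [norm_outerSelf, ← h1] at h2
  have h3 := mul_le_mul_of_nonneg_right h (sq_nonneg ‖u‖)
  linarith

theorem norm_sq_centeredMatrix_transpose_mulVec (X : Fin n → EuclideanSpace ℝ (Fin d))
    (R : Finset (Fin n)) (u : EuclideanSpace ℝ (Fin d)) :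
    ‖(EuclideanSpace.equiv (Fin n) ℝ).symm
        (Matrix.mulVec (centeredMatrix X R).conjTranspose u)‖ ^ 2 =
      ∑ i ∈ R, inner ℝ (X i - centroid X R) u ^ 2 := by
  have h : ∀ i, Matrix.mulVec (centeredMatrix X R).conjTranspose u i =
      if i ∈ R then inner ℝ (X i - centroid X R) u else 0 := fun i => by
    simp only [Matrix.mulVec, dotProduct, centeredMatrix, Matrix.conjTranspose_apply,
      Matrix.of_apply, star_trivial]
    split_ifs
    · rw [PiLp.inner_apply]
      exact Finset.sum_congr rfl fun a _ => by simp [mul_comm]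
    · simp
  rw [EuclideanSpace.norm_sq_eq]
  simp only [PiLp.continuousLinearEquiv_symm_apply, h]
  simp [apply_ite (fun t : ℝ => t ^ 2), Finset.sum_ite_mem]

open scoped Matrix.Norms.L2Operator in
theorem sum_inner_sq_le_spectralNorm (X : Fin n → EuclideanSpace ℝ (Fin d)) (R : Finset (Fin n))
    (u : EuclideanSpace ℝ (Fin d)) :
    ∑ i ∈ R, inner ℝ (X i - centroid X R) u ^ 2 ≤
      spectralNorm (centeredMatrix X R) ^ 2 * ‖u‖ ^ 2 := by
  have h := pow_le_pow_left₀ (norm_nonneg _)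
    (Matrix.l2_opNorm_mulVec (centeredMatrix X R).conjTranspose u) 2
  rw [norm_sq_centeredMatrix_transpose_mulVec, Matrix.l2_opNorm_conjTranspose, mul_pow] at h
  exact h

open scoped Matrix.Norms.L2Operator in
theorem spectralNorm_sq_le (X : Fin n → EuclideanSpace ℝ (Fin d)) (R : Finset (Fin n)) {r : ℝ}
    (hr0 : 0 ≤ r) (hr : ∀ i ∈ R, ‖X i - centroid X R‖ ≤ r) :
    spectralNorm (centeredMatrix X R) ^ 2 ≤ R.card * r ^ 2 := by
  have key : spectralNorm (centeredMatrix X R) ≤ Real.sqrt R.card * r := by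
    rw [spectralNorm, ← Matrix.l2_opNorm_conjTranspose, Matrix.l2_opNorm_def]
    refine ContinuousLinearMap.opNorm_le_bound _ (by positivity) fun u => ?_
    refine le_of_sq_le_sq ?_ (by positivity)
    refine (norm_sq_centeredMatrix_transpose_mulVec X R u).trans_le ?_
    calc _ ≤ ∑ i ∈ R, (r * ‖u‖) ^ 2 := Finset.sum_le_sum fun i hi => by
          refine sq_le_sq' ?_ ?_ <;>
          nlinarith [abs_le.1 (abs_real_inner_le_norm (X i - centroid X R) u),
            mul_le_mul_of_nonneg_right (hr i hi) (norm_nonneg u)]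
      _ = _ := by
          rw [Finset.sum_const, nsmul_eq_mul, mul_pow, mul_pow, mul_pow,
            Real.sq_sqrt (Nat.cast_nonneg _), mul_assoc]
  calc _ ≤ (Real.sqrt R.card * r) ^ 2 := pow_le_pow_left₀ (norm_nonneg _) key 2
    _ = _ := by rw [mul_pow, Real.sq_sqrt (Nat.cast_nonneg _)]

/-- The sketch `W` samples every cluster nearly proportionally: the cluster sizes, the sums and the
second moments of the centered points deviate from `p` times their full values by at most the
fraction `2s`. -/
structure IsRepresentative (X : Fin n → EuclideanSpace ℝ (Fin d))
    (Γ : Finpartition (Finset.univ : Finset (Fin n))) (p s r : ℝ) (W : Finset (Fin n)) : Prop where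
  card_dev : ∀ S ∈ Γ.parts, |((S ∩ W).card : ℝ) - p * S.card| ≤ 2 * s * (p * S.card)
  sum_dev : ∀ S ∈ Γ.parts, ‖∑ i ∈ S ∩ W, (X i - centroid X S)‖ ≤ 2 * s * (p * S.card) * r
  outer_dev : ∀ S ∈ Γ.parts, ‖∑ i ∈ S ∩ W, outerSelf (X i - centroid X S) -
    p • ∑ i ∈ S, outerSelf (X i - centroid X S)‖ ≤ 2 * s * (p * S.card) * r ^ 2

theorem norm_centroid_sub_le {X : Fin n → EuclideanSpace ℝ (Fin d)} {S S' : Finset (Fin n)}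
    {η : ℝ} (h0 : S'.Nonempty) (h : ‖∑ i ∈ S', (X i - centroid X S)‖ ≤ η * S'.card) :
    ‖centroid X S' - centroid X S‖ ≤ η := by
  have hc : (0 : ℝ) < S'.card := Nat.cast_pos.2 h0.card_pos
  have : centroid X S' - centroid X S = (S'.card : ℝ)⁻¹ • ∑ i ∈ S', (X i - centroid X S) := by
    rw [Finset.sum_sub_distrib, Finset.sum_const, smul_sub, ← Nat.cast_smul_eq_nsmul ℝ,
      inv_smul_smul₀ hc.ne', centroid]
  rw [this, norm_smul, norm_inv, Real.norm_of_nonneg hc.le, inv_mul_le_iff₀ hc, mul_comm]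
  exact h

/-- A representative sketch of a clustering that satisfies the proximity condition with a
sufficient margin leads to exact recovery. -/
theorem exactlyRecovers_of_isRepresentative {X : Fin n → EuclideanSpace ℝ (Fin d)}
    {Γ : Finpartition (Finset.univ : Finset (Fin n))} {p s r m : ℝ} {W : Finset (Fin n)}
    (hΓ : Γ.parts.Nonempty) (hp : 0 < p) (hs0 : 0 ≤ s) (hs : s ≤ 1 / 4) (hr0 : 0 ≤ r)
    (hr : ∀ S ∈ Γ.parts, ∀ i ∈ S, ‖X i - centroid X S‖ ≤ r)
    (hm0 : 0 < m) (hm : ∀ S ∈ Γ.parts, m ≤ S.card)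
    (hmargin : ∀ S ∈ Γ.parts, ∀ T ∈ Γ.parts, S ≠ T → ∀ i ∈ S,
      beta X Γ S T + 4 * r * s * (3 + 4 * r / ‖centroid X S - centroid X T‖) +
          2 * r * Real.sqrt (s * n / m) <
        inner ℝ (X i - (1 / 2 : ℝ) • (centroid X S + centroid X T))
          (direction (centroid X S) (centroid X T)))
    (hW : IsRepresentative X Γ p s r W) : ExactlyRecovers X Γ.parts.card W Γ := by
  have hsz : ∀ S ∈ Γ.parts, (1 - 2 * s) * (p * S.card) ≤ ((S ∩ W).card : ℝ) := fun S hS => by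
    have := (abs_le.1 (hW.card_dev S hS)).1
    linarith
  have hpos : ∀ S ∈ Γ.parts, 0 < p * (S.card : ℝ) := fun S hS =>
    mul_pos hp (hm0.trans_le (hm S hS))
  have hpos' : ∀ S ∈ Γ.parts, 0 < ((S ∩ W).card : ℝ) := fun S hS =>
    (mul_pos (by linarith) (hpos S hS)).trans_le (hsz S hS)
  have hne : ∀ S ∈ Γ.parts, (S ∩ W).Nonempty := fun S hS =>
    Finset.card_pos.1 (Nat.cast_pos.1 (hpos' S hS))
  have hcent : ∀ S ∈ Γ.parts, ‖centroid X (S ∩ W) - centroid X S‖ ≤ 4 * r * s := fun S hS => by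
    refine norm_centroid_sub_le (hne S hS) ((hW.sum_dev S hS).trans ?_)
    have h1 : p * (S.card : ℝ) ≤ 2 * (S ∩ W).card := by nlinarith [hsz S hS, hpos S hS]
    nlinarith [mul_le_mul_of_nonneg_left h1 (mul_nonneg hr0 hs0)]
  have hn : ∑ S ∈ Γ.parts, (S.card : ℝ) = n := by
    rw [← Nat.cast_sum, Γ.sum_card_parts, Finset.card_univ, Fintype.card_fin]
  have hV : ∑ R ∈ Γ.parts, spectralNorm (centeredMatrix X R) ^ 2 ≤ n * r ^ 2 := by
    rw [← hn, Finset.sum_mul]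
    exact Finset.sum_le_sum fun R hR => spectralNorm_sq_le X R hr0 (hr R hR)
  have hV0 : 0 ≤ ∑ R ∈ Γ.parts, spectralNorm (centeredMatrix X R) ^ 2 :=
    Finset.sum_nonneg fun R _ => sq_nonneg _
  set V := ∑ R ∈ Γ.parts, spectralNorm (centeredMatrix X R) ^ 2 with hVdef
  set N : Finset (Fin n) → ℝ := fun S =>
    p * spectralNorm (centeredMatrix X S) ^ 2 + 2 * s * (p * S.card) * r ^ 2 with hN
  have hN0 : ∀ S, 0 ≤ N S := fun S => by positivity
  have hNsum : ∑ S ∈ Γ.parts, N S = p * (V + 2 * s * n * r ^ 2) := by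
    simp only [hN, Finset.sum_add_distrib, ← Finset.mul_sum, ← Finset.sum_mul, hn]
    ring
  obtain ⟨S₀, hS₀⟩ := hΓ
  refine exactlyRecovers_of_proximity ((hne S₀ hS₀).mono Finset.inter_subset_right) hne N
    (fun S _ => hN0 S) (fun S hS => ?_) (fun S hS T hT hST i hi => ?_)
  · refine norm_sum_smul_sub_sq_le (c := centroid X S) (hN0 S) (sum_sub_centroid X _)
      (norm_sum_smul_sq_le (hN0 S) fun u => ?_)
    refine (sum_inner_sq_le_of_outer_deviation (hW.outer_dev S hS) u).trans ?_
    have := mul_le_mul_of_nonneg_left (sum_inner_sq_le_spectralNorm X S u) hp.le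
    simp only [hN]
    linarith
  have hmar := hmargin S hS T hT hST i hi
  have hbeta0 : 0 ≤ beta X Γ S T := by unfold beta; positivity
  have hcne : centroid X S ≠ centroid X T := fun h => by
    rw [h, direction_self, inner_zero_right] at hmar
    have : 0 ≤ 4 * r * s * (3 + 4 * r / ‖centroid X T - centroid X T‖) := by positivity
    have : 0 ≤ 2 * r * Real.sqrt (s * n / m) := by positivity
    linarith
  have hpert := inner_direction_perturb hcne (hr S hS i hi) (hcent S hS) (hcent T hT)
  refine lt_of_lt_of_le ?_ hpert
  -- The factor `1 + 4s` inverts the size loss: `(1 + 4s)(1 - 2s) ≥ 1` exactly because `0 ≤ s ≤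
  -- 1/4`.
  have hinv : ∀ R ∈ Γ.parts, 1 / ((R ∩ W).card : ℝ) ≤ (1 + 4 * s) / p * (1 / R.card) :=
    fun R hR => by
    have hR0 : (0 : ℝ) < R.card := hm0.trans_le (hm R hR)
    rw [div_mul_div_comm, mul_one, div_le_div_iff₀ (hpos' R hR) (hpos R hR), one_mul]
    have h1 := mul_le_mul_of_nonneg_left (hsz R hR) (show 0 ≤ 1 + 4 * s by linarith)
    have h2 : 1 ≤ (1 + 4 * s) * (1 - 2 * s) := by nlinarith
    nlinarith [mul_le_mul_of_nonneg_right h2 (hpos R hR).le]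
  set h : ℝ := 1 / (S.card : ℝ) + 1 / (T.card : ℝ) with hh
  have hh0 : 0 ≤ h := by positivity
  have hhm : h ≤ 2 / m := by
    have h1 := one_div_le_one_div_of_le hm0 (hm S hS)
    have h2 := one_div_le_one_div_of_le hm0 (hm T hT)
    rw [hh, show 2 / m = 1 / m + 1 / m by ring]
    linarith
  have hsum : (1 / ((S ∩ W).card : ℝ) + 1 / ((T ∩ W).card : ℝ)) * ∑ R ∈ Γ.parts, N R ≤
      h * V + 16 * (s * n / m) * r ^ 2 := by
    rw [hNsum]
    calc _ ≤ ((1 + 4 * s) / p * h) * (p * (V + 2 * s * n * r ^ 2)) := by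
          gcongr
          rw [hh, mul_add]
          exact add_le_add (hinv S hS) (hinv T hT)
      _ = h * V + h * (4 * s * V + (1 + 4 * s) * (2 * s * n * r ^ 2)) := by
          field_simp; ring
      _ ≤ h * V + 2 / m * (4 * s * (n * r ^ 2) + 2 * (2 * s * n * r ^ 2)) := by
          gcongr; linarith
      _ = _ := by ring
  -- The additive error of order `s` under the root becomes `√s` outside it, the source of the
  -- `c^{-1/4}` term.
  have hsqrt : 1 / 2 * Real.sqrt ((1 / ((S ∩ W).card : ℝ) + 1 / ((T ∩ W).card : ℝ)) *
      ∑ R ∈ Γ.parts, N R) ≤ beta X Γ S T + 2 * r * Real.sqrt (s * n / m) := by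
    have e1 : Real.sqrt (16 * (s * n / m) * r ^ 2) = 4 * r * Real.sqrt (s * n / m) := by
      rw [show 16 * (s * n / m) * r ^ 2 = (4 * r) ^ 2 * (s * n / m) by ring,
        Real.sqrt_mul (sq_nonneg _), Real.sqrt_sq (by positivity)]
    have h1 := (Real.sqrt_le_sqrt hsum).trans
      (sqrt_add_le_add_sqrt (mul_nonneg hh0 hV0) (b := 16 * (s * n / m) * r ^ 2) (by positivity))
    rw [e1] at h1
    have h2 : beta X Γ S T = 1 / 2 * Real.sqrt (h * V) := rfl
    rw [h2]
    linarith
  linarith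

end Perturbation

/-! ### Monotonicity of the shape function -/

section Monotonicity

theorem logTerm₁_mono {d d' k k' : ℕ} (hd : d ≤ d') (hk : k ≤ k') :
    logTerm₁ d k ≤ logTerm₁ d' k' := by
  unfold logTerm₁
  -- For `k = 0` the left side is zero because `Real.log 0 = 0`.
  rcases Nat.eq_zero_or_pos k with rfl | hk0
  · simp
  have : (0 : ℝ) < k := Nat.cast_pos.2 hk0
  have := Real.log_pos one_lt_two
  gcongr

theorem logTerm₂_mono {d d' k k' : ℕ} (hd : d ≤ d') (hk : k ≤ k') :
    logTerm₂ d k ≤ logTerm₂ d' k' := by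
  unfold logTerm₂
  rcases Nat.eq_zero_or_pos k with rfl | hk0
  · simp
  have : (0 : ℝ) < k := Nat.cast_pos.2 hk0
  have := Real.log_pos one_lt_two
  gcongr

variable {d d' k k' : ℕ} {δ δ' ρ ρ' πmin πmin' πmax πmax' : ℝ≥0∞}

theorem threshold₁_mono (hd : d ≤ d') (hk : k ≤ k') (hM : πmax ≤ πmax') (hm : πmin' ≤ πmin) :
    threshold₁ d k πmin πmax ≤ threshold₁ d' k' πmin' πmax' := by
  have := logTerm₁_mono hd hk
  unfold threshold₁
  gcongr

theorem coeffA_mono (hd : d ≤ d') (hk : k ≤ k') (hδ : δ' ≤ δ) (hm : πmin' ≤ πmin) :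
    coeffA d δ k πmin ≤ coeffA d' δ' k' πmin' := by
  have := logTerm₂_mono hd hk
  unfold coeffA
  gcongr

theorem coeffB_mono (hd : d ≤ d') (hk : k ≤ k') (hM : πmax ≤ πmax') (hm : πmin' ≤ πmin) :
    coeffB d k πmin πmax ≤ coeffB d' k' πmin' πmax' := by
  have := logTerm₁_mono hd hk
  unfold coeffB
  gcongr

theorem threshold₂_mono (hd : d ≤ d') (hk : k ≤ k') (hM : πmax ≤ πmax') (hδ : δ' ≤ δ)
    (hρ : ρ' ≤ ρ) (hm : πmin' ≤ πmin) :
    threshold₂ d δ ρ k πmin πmax ≤ threshold₂ d' δ' ρ' k' πmin' πmax' := by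
  have := coeffA_mono hd hk hδ hm
  have := coeffB_mono hd hk hM hm
  unfold threshold₂
  gcongr

theorem shapeFunction_mono (hd : d ≤ d') (hk : k ≤ k') (hM : πmax ≤ πmax') (hδ : δ' ≤ δ)
    (hρ : ρ' ≤ ρ) (hm : πmin' ≤ πmin) :
    shapeFunction d δ ρ k πmin πmax ≤ shapeFunction d' δ' ρ' k' πmin' πmax' :=
  max_le_max (threshold₁_mono hd hk hM hm) (threshold₂_mono hd hk hM hδ hρ hm)

end Monotonicity

/-! ### Probability that the sketch is representative -/

section Probability

variable {n d : ℕ}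

/-- Apply the Bernstein bound to `v` extended by zero off `S`. Using a lower bound `N` for `p|S|`
gives one relative error valid for all clusters. -/
theorem sketchLaw_sum_deviation_le {H : Type*} [NormedAddCommGroup H] [InnerProductSpace ℝ H]
    (p : unitInterval) (S : Finset (Fin n)) (v : Fin n → H) {a N Λ : ℝ} (ha : 0 ≤ a)
    (hv : ∀ i ∈ S, ‖v i‖ ≤ a) (hN0 : 0 < N) (hN : N ≤ p * S.card) (hΛ0 : 0 ≤ Λ) (hΛ : Λ ≤ N) :
    (sketchLaw n p).real {W | 2 * Real.sqrt (Λ / N) * (p * S.card) * a <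
      ‖∑ i ∈ S ∩ W.toFinite.toFinset, v i - (p : ℝ) • ∑ i ∈ S, v i‖} ≤ 2 * Real.exp (-Λ) := by
  classical
  rcases ha.eq_or_lt with rfl | ha
  · have hv0 : ∀ i ∈ S, v i = 0 := fun i hi => norm_le_zero_iff.1 (hv i hi)
    have : {W : Set (Fin n) | 2 * Real.sqrt (Λ / N) * (p * S.card) * 0 <
        ‖∑ i ∈ S ∩ W.toFinite.toFinset, v i - (p : ℝ) • ∑ i ∈ S, v i‖} = ∅ := by
      refine Set.eq_empty_of_forall_notMem fun W hW => ?_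
      rw [Set.mem_ofPred_eq, Finset.sum_eq_zero hv0,
        Finset.sum_eq_zero fun i hi => hv0 i (Finset.mem_inter.1 hi).1] at hW
      simp at hW
    rw [this, measureReal_empty]
    positivity
  have hb : 0 < (p : ℝ) * S.card := hN0.trans_le hN
  have hdev := sketchLaw_norm_deviation_le p (fun i => if i ∈ S then v i else 0) (r := a)
    (N := p * S.card) (Λ := Λ) ha (fun i => by
      split_ifs with h
      · exact hv i h
      · simpa using ha.le) (by
      rw [mul_assoc]
      refine mul_le_mul_of_nonneg_left ?_ p.2.1
      simp only [apply_ite norm, norm_zero, ite_pow, ne_eq, OfNat.ofNat_ne_zero,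
        not_false_eq_true, zero_pow]
      rw [Finset.sum_ite_mem, Finset.univ_inter, ← nsmul_eq_mul]
      exact Finset.sum_le_card_nsmul _ _ _ fun i hi => by
        have := hv i hi
        gcongr) hb hΛ0 (hΛ.trans hN)
  refine (measureReal_mono (fun W hW => ?_) (by rw [sketchLaw]; exact measure_ne_top _ _)).trans hdev
  rw [Set.mem_ofPred_eq] at hW ⊢
  rw [Finset.sum_ite_mem, Finset.sum_ite_mem, Finset.univ_inter, Finset.inter_comm]
  refine lt_of_le_of_lt ?_ hW
  have h1 : Real.sqrt (p * S.card * Λ) ≤ Real.sqrt (Λ / N) * (p * S.card) := by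
    rw [Real.sqrt_le_left (by positivity), mul_pow, Real.sq_sqrt (by positivity)]
    calc (p : ℝ) * S.card * Λ = Λ / N * (p * S.card * N) := by field_simp
      _ ≤ Λ / N * (p * S.card) ^ 2 := by
          rw [sq]; gcongr
  nlinarith

/-- Union bound over three deviations per cluster, each of probability at most `2e^{-Λ}`; sizes are
sums of the constant `1`. -/
theorem sketchLaw_not_isRepresentative_le (p : unitInterval) (X : Fin n → EuclideanSpace ℝ (Fin d))
    (Γ : Finpartition (Finset.univ : Finset (Fin n))) {r N Λ : ℝ} (hr0 : 0 ≤ r)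
    (hr : ∀ S ∈ Γ.parts, ∀ i ∈ S, ‖X i - centroid X S‖ ≤ r) (hN0 : 0 < N)
    (hN : ∀ S ∈ Γ.parts, N ≤ p * S.card) (hΛ0 : 0 ≤ Λ) (hΛ : Λ ≤ N) :
    (sketchLaw n p).real {W | ¬ IsRepresentative X Γ p (Real.sqrt (Λ / N)) r W.toFinite.toFinset} ≤
      6 * Γ.parts.card * Real.exp (-Λ) := by
  have : IsProbabilityMeasure (sketchLaw n p) := by unfold sketchLaw; infer_instance
  set E₁ : Finset (Fin n) → Set (Set (Fin n)) := fun S =>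
    {W | 2 * Real.sqrt (Λ / N) * (p * S.card) * 1 <
      ‖∑ i ∈ S ∩ W.toFinite.toFinset, (1 : ℝ) - (p : ℝ) • ∑ i ∈ S, (1 : ℝ)‖} with hE₁
  set E₂ : Finset (Fin n) → Set (Set (Fin n)) := fun S =>
    {W | 2 * Real.sqrt (Λ / N) * (p * S.card) * r <
      ‖∑ i ∈ S ∩ W.toFinite.toFinset, (X i - centroid X S) -
        (p : ℝ) • ∑ i ∈ S, (X i - centroid X S)‖} with hE₂
  set E₃ : Finset (Fin n) → Set (Set (Fin n)) := fun S =>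
    {W | 2 * Real.sqrt (Λ / N) * (p * S.card) * r ^ 2 <
      ‖∑ i ∈ S ∩ W.toFinite.toFinset, outerSelf (X i - centroid X S) -
        (p : ℝ) • ∑ i ∈ S, outerSelf (X i - centroid X S)‖} with hE₃
  have hsub : {W : Set (Fin n) | ¬ IsRepresentative X Γ p (Real.sqrt (Λ / N)) r
      W.toFinite.toFinset} ⊆ ⋃ S ∈ Γ.parts, (E₁ S ∪ E₂ S ∪ E₃ S) := by
    intro W hW
    by_contra hcon
    simp only [Set.mem_iUnion, not_exists, Set.mem_union, not_or, hE₁, hE₂, hE₃,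
      Set.mem_ofPred_eq, not_lt] at hcon
    refine hW ⟨fun S hS => ?_, fun S hS => ?_, fun S hS => (hcon S hS).2⟩
    · have := (hcon S hS).1.1
      simpa [Real.norm_eq_abs] using this
    · have := (hcon S hS).1.2
      rwa [sum_sub_centroid, smul_zero, sub_zero] at this
  calc _ ≤ (sketchLaw n p).real (⋃ S ∈ Γ.parts, (E₁ S ∪ E₂ S ∪ E₃ S)) :=
        measureReal_mono hsub (measure_ne_top _ _)
    _ ≤ ∑ S ∈ Γ.parts, (sketchLaw n p).real (E₁ S ∪ E₂ S ∪ E₃ S) :=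
        measureReal_biUnion_finset_le _ _
    _ ≤ ∑ S ∈ Γ.parts, 6 * Real.exp (-Λ) := by
        refine Finset.sum_le_sum fun S hS => ?_
        have h1 := sketchLaw_sum_deviation_le p S (fun _ => (1 : ℝ)) zero_le_one (by simp) hN0
          (hN S hS) hΛ0 hΛ
        have h2 := sketchLaw_sum_deviation_le p S (fun i => X i - centroid X S) hr0 (hr S hS) hN0
          (hN S hS) hΛ0 hΛ
        have h3 := sketchLaw_sum_deviation_le p S (fun i => outerSelf (X i - centroid X S))
          (sq_nonneg r) (fun i hi => by
            rw [norm_outerSelf]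
            exact pow_le_pow_left₀ (norm_nonneg _) (hr S hS i hi) 2) hN0 (hN S hS) hΛ0 hΛ
        have h4 := measureReal_union_le (μ := sketchLaw n p) (E₁ S ∪ E₂ S) (E₃ S)
        have h5 := measureReal_union_le (μ := sketchLaw n p) (E₁ S) (E₂ S)
        linarith
    _ = _ := by rw [Finset.sum_const, nsmul_eq_mul]; ring

theorem sketchLaw_mem (p : unitInterval) (i : Fin n) :
    sketchLaw n p {W | i ∈ W} = ENNReal.ofReal p := by
  classical
  calc sketchLaw n p {W | i ∈ W}
      = Measure.infinitePi (fun j ↦ unitInterval.toNNReal p • Measure.dirac (j ∈ Set.univ) +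
          unitInterval.toNNReal (unitInterval.symm p) • Measure.dirac False)
          (cylinder {i} {fun _ ↦ True}) := by
        rw [sketchLaw, setBernoulli_apply']; congr!; ext; simp [funext_iff]
    _ = ENNReal.ofReal p := by
        simp [Measure.infinitePi_cylinder]
        rw [ENNReal.ofReal]
        congr 1
        ext
        simpa using p.2.1

theorem expectedSketchSize_eq (p : unitInterval) :
    expectedSketchSize n p = ENNReal.ofReal (p * n) := by
  classical
  have h : ∀ W : Set (Fin n), (W.ncard : ℝ≥0∞) =
      ∑ i, Set.indicator {W : Set (Fin n) | i ∈ W} 1 W := fun W => by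
    simp [Set.indicator_apply, Set.ncard_eq_toFinset_card', Finset.sum_boole]
  simp only [expectedSketchSize, h]
  rw [lintegral_finsetSum _ fun i _ => Measurable.of_discrete]
  have h2 : ∀ i, ∫⁻ W, Set.indicator {W : Set (Fin n) | i ∈ W} 1 W ∂(sketchLaw n p) =
      ENNReal.ofReal p := fun i => by
    rw [lintegral_indicator_one MeasurableSet.of_discrete, sketchLaw_mem]
  simp [h2, ENNReal.ofReal_mul p.2.1, mul_comm]

end Probability

/-! ### From the shape parameter to the margin inequality -/

section ShapeParameter

/-- The real number `(2 / log 2) · log(8 k² (d + 2))`. -/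
def logConst (d k : ℕ) : ℝ :=
  2 / Real.log 2 * Real.log (8 * (k : ℝ) ^ 2 * ((d : ℝ) + 2))

theorem sixteen_mul_le {k : ℕ} (d : ℕ) (hk : 1 ≤ k) :
    16 * (k : ℝ) ≤ 8 * (k : ℝ) ^ 2 * ((d : ℝ) + 2) := by
  have h1 : (1 : ℝ) ≤ k := Nat.one_le_cast.2 hk
  have h2 : (0 : ℝ) ≤ d := Nat.cast_nonneg d
  nlinarith [mul_nonneg (sq_nonneg (k : ℝ)) h2]

theorem logConst_nonneg {k : ℕ} (d : ℕ) (hk : 1 ≤ k) : 0 ≤ logConst d k := by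
  have h1 : (1 : ℝ) ≤ k := Nat.one_le_cast.2 hk
  have := Real.log_nonneg (show 1 ≤ 8 * (k : ℝ) ^ 2 * ((d : ℝ) + 2) by
    linarith [sixteen_mul_le d hk])
  have := Real.log_pos one_lt_two
  unfold logConst
  positivity

theorem ofReal_logConst_le {k : ℕ} (d : ℕ) (hk : 1 ≤ k) :
    ENNReal.ofReal (logConst d k) ≤ logTerm₁ d k := by
  unfold logConst logTerm₁
  have h1 : (1 : ℝ) ≤ k := Nat.one_le_cast.2 hk
  have h2 : (0 : ℝ) ≤ d := Nat.cast_nonneg d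
  have := Real.log_pos one_lt_two
  have h3 : 8 * (k : ℝ) ^ 2 * ((d : ℝ) + 2) ≤ 36 * (k : ℝ) ^ 3 * ((d : ℝ) + 1) := by
    have e : (k : ℝ) ^ 2 ≤ (k : ℝ) ^ 3 := pow_le_pow_right₀ h1 (by norm_num)
    calc 8 * (k : ℝ) ^ 2 * ((d : ℝ) + 2) ≤ 36 * (k : ℝ) ^ 2 * ((d : ℝ) + 1) := by
          nlinarith [sq_nonneg (k : ℝ), mul_nonneg (sq_nonneg (k : ℝ)) h2]
      _ ≤ _ := by gcongr
  gcongr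

variable {d k : ℕ} {δ ρ πm πM : ℝ}

theorem ofReal_le_threshold₁ (hk : 1 ≤ k) (hm : 0 < πm) (hmM : πm ≤ πM) :
    ENNReal.ofReal (48 * logConst d k / πm) ≤
      threshold₁ d k (ENNReal.ofReal πm) (ENNReal.ofReal πM) := by
  have h1 : 1 ≤ ENNReal.ofReal πM / ENNReal.ofReal πm := by
    rw [← ENNReal.ofReal_div_of_pos hm, ENNReal.one_le_ofReal, one_le_div hm]
    exact hmM
  have h2 := ofReal_logConst_le d hk
  rw [ENNReal.ofReal_div_of_pos hm, ENNReal.ofReal_mul (by norm_num)]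
  unfold threshold₁
  calc _ = 48 * 1 ^ 2 * ENNReal.ofReal (logConst d k) / ENNReal.ofReal πm := by simp
    _ ≤ _ := by gcongr

theorem ofReal_le_coeffA (hk : 1 ≤ k) (hδ : 0 < δ) (hm : 0 < πm) :
    ENNReal.ofReal ((2 / δ + 3 / 2) * 8 * Real.sqrt (logConst d k / πm)) ≤
      coeffA d (ENNReal.ofReal δ) k (ENNReal.ofReal πm) := by
  have h0 := logConst_nonneg d hk
  unfold coeffA
  rw [show logTerm₂ d k = ENNReal.ofReal (logConst d k) from rfl, Real.sqrt_eq_rpow,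
    ENNReal.ofReal_mul (by positivity), ENNReal.ofReal_mul (by positivity),
    ENNReal.ofReal_add (by positivity) (by positivity), ENNReal.ofReal_div_of_pos hδ,
    ENNReal.ofReal_div_of_pos (by norm_num), ← ENNReal.ofReal_rpow_of_nonneg (by positivity)
      (by norm_num), ENNReal.ofReal_div_of_pos hm]
  simp

/-- The argument needs less than `B` provides: `kπM ≥ 1` removes the factor `kπM`, and `16√3 +
√(104/3) ≥ 16`. -/
theorem ofReal_le_coeffB (hk : 1 ≤ k) (hm : 0 < πm) (hM : 0 < πM) (hkM : 1 ≤ k * πM) :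
    ENNReal.ofReal (2 * Real.sqrt (Real.sqrt (logConst d k / πm) / πm)) ≤
      coeffB d k (ENNReal.ofReal πm) (ENNReal.ofReal πM) := by
  have h0 := logConst_nonneg d hk
  have h2 := ofReal_logConst_le d hk
  have hk0 : (0 : ℝ) < k := Nat.cast_pos.2 hk
  have h16 : (16 : ℝ) ≤ 16 * Real.sqrt 3 + Real.sqrt (104 / 3) := by
    have h3 : 1 ≤ Real.sqrt 3 := Real.one_le_sqrt.2 (by norm_num)
    have := Real.sqrt_nonneg (104 / 3)
    linarith
  have e1 : 2 * Real.sqrt (Real.sqrt (logConst d k / πm) / πm) ≤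
      1 / 2 * Real.sqrt (16 * k * (πM / πm) * Real.sqrt (logConst d k / πm)) := by
    have : Real.sqrt (4 ^ 2 * (Real.sqrt (logConst d k / πm) / πm)) ≤
        Real.sqrt (16 * k * (πM / πm) * Real.sqrt (logConst d k / πm)) := by
      apply Real.sqrt_le_sqrt
      have : 0 ≤ Real.sqrt (logConst d k / πm) / πm := by positivity
      calc _ = 16 * 1 * (Real.sqrt (logConst d k / πm) / πm) := by ring
        _ ≤ 16 * (k * πM) * (Real.sqrt (logConst d k / πm) / πm) := by gcongr
        _ = _ := by ring
    rw [Real.sqrt_mul (by positivity), Real.sqrt_sq (by norm_num)] at this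
    linarith
  refine (ENNReal.ofReal_le_ofReal e1).trans ?_
  unfold coeffB
  rw [ENNReal.ofReal_mul (by norm_num), Real.sqrt_eq_rpow, ← ENNReal.ofReal_rpow_of_nonneg
    (by positivity) (by norm_num), ENNReal.ofReal_mul (by positivity),
    ENNReal.ofReal_mul (by positivity), ENNReal.ofReal_mul (by norm_num), Real.sqrt_eq_rpow,
    ← ENNReal.ofReal_rpow_of_nonneg (by positivity) (by norm_num), ENNReal.ofReal_div_of_pos hm,
    ENNReal.ofReal_div_of_pos hm, ENNReal.ofReal_div_of_pos (by norm_num), ENNReal.ofReal_natCast,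
    ENNReal.ofReal_one, ENNReal.ofReal_ofNat 2]
  gcongr

/-- The positive root `t` of `ρ t² = b t + a`. -/
def positiveRoot (a b ρ : ℝ) : ℝ := b / (2 * ρ) + Real.sqrt ((b / (2 * ρ)) ^ 2 + a / ρ)

theorem positiveRoot_nonneg {a b : ℝ} (hb : 0 ≤ b) (hρ : 0 < ρ) : 0 ≤ positiveRoot a b ρ := by
  unfold positiveRoot
  positivity

theorem ofReal_le_threshold₂ {a b : ℝ} (ha : 0 ≤ a) (hb : 0 ≤ b) (hρ : 0 < ρ) {δ πm πM : ℝ≥0∞}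
    (hA : ENNReal.ofReal a ≤ coeffA d δ k πm) (hB : ENNReal.ofReal b ≤ coeffB d k πm πM) :
    ENNReal.ofReal (positiveRoot a b ρ ^ 4) ≤
      threshold₂ d δ (ENNReal.ofReal ρ) k πm πM := by
  unfold threshold₂ positiveRoot
  have hρ2 : ENNReal.ofReal (2 * ρ) = 2 * ENNReal.ofReal ρ := by
    rw [ENNReal.ofReal_mul (by norm_num)]; simp
  rw [ENNReal.ofReal_pow (by positivity), ENNReal.ofReal_add (by positivity) (by positivity),
    Real.sqrt_eq_rpow, ← ENNReal.ofReal_rpow_of_nonneg (by positivity) (by norm_num),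
    ENNReal.ofReal_add (by positivity) (by positivity), ENNReal.ofReal_pow (by positivity),
    ENNReal.ofReal_div_of_pos (by positivity), ENNReal.ofReal_div_of_pos hρ, hρ2]
  gcongr

/-- Completing the square: the hypothesis says `(y - t)² > t² + a/ρ` with `t = b/(2ρ)`. -/
theorem lt_mul_sq_of_positiveRoot_lt {a b y : ℝ} (hb : 0 ≤ b) (hρ : 0 < ρ)
    (h : positiveRoot a b ρ < y) : b * y + a < ρ * y ^ 2 := by
  unfold positiveRoot at h
  set t := b / (2 * ρ) with ht
  have ht0 : 0 ≤ t := by positivity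
  have h1 : Real.sqrt (t ^ 2 + a / ρ) < y - t := by linarith
  have h2 := (Real.sqrt_lt' ((Real.sqrt_nonneg _).trans_lt h1)).1 h1
  have h3 : b = 2 * ρ * t := by rw [ht]; field_simp
  have h4 : a / ρ < y ^ 2 - 2 * t * y := by nlinarith
  rw [div_lt_iff₀ hρ] at h4
  rw [h3]
  linarith

/-- Put `y = (pn/ℓ)^{1/4}`. Then `√(L/(m/n)) = s y²`, so dividing the quadratic inequality by `y²`
gives the margin; the coefficients agree since `8(2/δ + 3/2) = 4(3 + 4/δ)`. -/
theorem margin_of_positiveRoot_lt {L ℓ p n m γ D r : ℝ} (hL : 0 ≤ L) (hℓ : 0 < ℓ) (hp : 0 < p)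
    (hn : 0 < n) (hm : 0 < m) (hr : 0 < r) (hD : 0 < D) (hγ : 0 < γ)
    (h : positiveRoot ((2 / (D / r) + 3 / 2) * 8 * Real.sqrt (L / (m / n)))
      (2 * Real.sqrt (Real.sqrt (L / (m / n)) / (m / n))) (γ / r) ^ 4 * ℓ < p * n) :
    4 * r * Real.sqrt (L * ℓ / (p * m)) * (3 + 4 * r / D) +
      2 * r * Real.sqrt (Real.sqrt (L * ℓ / (p * m)) * n / m) < γ := by
  set s := Real.sqrt (L * ℓ / (p * m)) with hs
  set y := Real.sqrt (Real.sqrt (p * n / ℓ)) with hy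
  have hy0 : 0 < y := Real.sqrt_pos.2 (Real.sqrt_pos.2 (by positivity))
  have hy2 : y ^ 2 = Real.sqrt (p * n / ℓ) := Real.sq_sqrt (Real.sqrt_nonneg _)
  have hy4 : y ^ 4 = p * n / ℓ := by
    rw [show y ^ 4 = (y ^ 2) ^ 2 by ring, hy2, Real.sq_sqrt (by positivity)]
  rw [← lt_div_iff₀ hℓ, ← hy4] at h
  have h3 := lt_mul_sq_of_positiveRoot_lt (by positivity) (div_pos hγ hr)
    (lt_of_pow_lt_pow_left₀ 4 hy0.le h)
  have hsy : Real.sqrt (L / (m / n)) = s * y ^ 2 := by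
    rw [hy2, hs, ← Real.sqrt_mul (by positivity)]
    congr 1
    field_simp
  have hby : Real.sqrt (s * y ^ 2 / (m / n)) = y * Real.sqrt (s * n / m) := by
    rw [show s * y ^ 2 / (m / n) = y ^ 2 * (s * n / m) by field_simp,
      Real.sqrt_mul (sq_nonneg y), Real.sqrt_sq hy0.le]
  rw [hsy, hby] at h3
  have hkey : (2 * Real.sqrt (s * n / m) + (2 / (D / r) + 3 / 2) * 8 * s) * y ^ 2 <
      γ / r * y ^ 2 := by
    refine lt_of_eq_of_lt ?_ h3
    ring
  have h4 := lt_of_mul_lt_mul_right hkey (sq_nonneg y)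
  rw [lt_div_iff₀ hr] at h4
  refine lt_of_eq_of_lt ?_ h4
  field_simp
  ring

end ShapeParameter

/-! ### Finiteness of the shape parameter and the recovery probability -/

section Main

variable {n d : ℕ} {X : Fin n → EuclideanSpace ℝ (Fin d)}
  {Γ : Finpartition (Finset.univ : Finset (Fin n))}

theorem prox_le {S T : Finset (Fin n)} (hS : S ∈ Γ.parts) (hT : T ∈ Γ.parts) (hST : S ≠ T) :
    prox X Γ ≤ ((alpha X S T - beta X Γ S T : ℝ) : EReal) :=
  iInf₂_le_of_le S hS (iInf₂_le_of_le T hT (iInf_le _ hST))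

theorem separation_le {S T : Finset (Fin n)} (hS : S ∈ Γ.parts) (hT : T ∈ Γ.parts) (hST : S ≠ T) :
    separation X Γ ≤ edist (centroid X S) (centroid X T) :=
  iInf₂_le_of_le S hS (iInf₂_le_of_le T hT (iInf_le _ hST))

theorem alpha_le {S T : Finset (Fin n)} {i : Fin n} (hi : i ∈ S) :
    alpha X S T ≤ inner ℝ (X i - (1 / 2 : ℝ) • (centroid X S + centroid X T))
      (direction (centroid X S) (centroid X T)) :=
  ciInf_le (Set.finite_range _).bddBelow (⟨i, hi⟩ : S)

theorem beta_nonneg (S T : Finset (Fin n)) : 0 ≤ beta X Γ S T := by unfold beta; positivity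

theorem alpha_sub_beta_pos (hprox : 0 < prox X Γ) {S T : Finset (Fin n)} (hS : S ∈ Γ.parts)
    (hT : T ∈ Γ.parts) (hST : S ≠ T) : 0 < alpha X S T - beta X Γ S T :=
  EReal.coe_pos.1 (hprox.trans_le (prox_le hS hT hST))

/-- For equal centroids the direction is zero, so `α ≤ 0 ≤ β`. -/
theorem centroid_ne (hprox : 0 < prox X Γ) {S T : Finset (Fin n)} (hS : S ∈ Γ.parts)
    (hT : T ∈ Γ.parts) (hST : S ≠ T) : centroid X S ≠ centroid X T := fun h => by
  obtain ⟨i, hi⟩ := Γ.nonempty_of_mem_parts hS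
  have h1 := alpha_le (X := X) (T := T) hi
  rw [h, direction_self, inner_zero_right] at h1
  linarith [alpha_sub_beta_pos hprox hS hT hST, beta_nonneg (X := X) (Γ := Γ) S T]

theorem radius_ne_top : radius X Γ ≠ ⊤ := by
  unfold radius
  simp only [← Finset.sup_eq_iSup]
  refine ((Finset.sup_lt_iff ENNReal.zero_lt_top).2 fun S _ =>
    (Finset.sup_lt_iff ENNReal.zero_lt_top).2 fun i _ => ?_).ne
  exact edist_lt_top _ _

theorem separation_pos (hprox : 0 < prox X Γ) : 0 < separation X Γ := by
  unfold separation
  simp only [← Finset.inf_eq_iInf]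
  refine (Finset.lt_inf_iff ENNReal.zero_lt_top).2 fun S hS =>
    (Finset.lt_inf_iff ENNReal.zero_lt_top).2 fun T hT => ?_
  by_cases hST : S = T
  · simp [hST]
  · simp only [hST, ne_eq, not_false_eq_true, iInf_pos]
    exact edist_pos.2 (centroid_ne hprox hS hT hST)

theorem minFraction_pos : 0 < minFraction Γ := by
  unfold minFraction
  simp only [← Finset.inf_eq_iInf]
  refine (Finset.lt_inf_iff ENNReal.zero_lt_top).2 fun S hS => ?_
  exact ENNReal.div_pos (Nat.cast_ne_zero.2 (Γ.nonempty_of_mem_parts hS).card_pos.ne')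
    (ENNReal.natCast_ne_top n)

theorem maxFraction_le_one : maxFraction Γ ≤ 1 :=
  iSup₂_le fun S _ => ENNReal.div_le_of_le_mul (by
    rw [one_mul, Nat.cast_le]
    exact (Finset.card_le_univ S).trans_eq (Fintype.card_fin n))

theorem shapeParameter_lt_top (hprox : 0 < prox X Γ) : shapeParameter X Γ < ⊤ := by
  have hr_top := radius_ne_top (X := X) (Γ := Γ)
  have hm := (minFraction_pos (Γ := Γ)).ne'
  have hM : maxFraction Γ ≠ ⊤ := (maxFraction_le_one.trans_lt ENNReal.one_lt_top).ne
  have hδ : separation X Γ / radius X Γ ≠ 0 :=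
    (ENNReal.div_pos (separation_pos hprox).ne' hr_top).ne'
  have hρ : (prox X Γ).toENNReal / radius X Γ ≠ 0 :=
    (ENNReal.div_pos (EReal.toENNReal_ne_zero_iff.2 hprox) hr_top).ne'
  have hL₁ : logTerm₁ d Γ.parts.card ≠ ⊤ := ENNReal.ofReal_ne_top
  have hL₂ : logTerm₂ d Γ.parts.card ≠ ⊤ := ENNReal.ofReal_ne_top
  have hA : coeffA d (separation X Γ / radius X Γ) Γ.parts.card (minFraction Γ) ≠ ⊤ := by
    unfold coeffA
    refine ENNReal.mul_ne_top (ENNReal.mul_ne_top (ENNReal.add_ne_top.2 ⟨?_, ?_⟩) (by simp)) ?_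
    · exact ENNReal.div_ne_top (by simp) hδ
    · exact ENNReal.div_ne_top (by simp) (by simp)
    · exact ENNReal.rpow_ne_top_of_nonneg (by norm_num) (ENNReal.div_ne_top hL₂ hm)
  have hB : coeffB d Γ.parts.card (minFraction Γ) (maxFraction Γ) ≠ ⊤ := by
    unfold coeffB
    refine ENNReal.mul_ne_top (ENNReal.div_ne_top (by simp) (by simp))
      (ENNReal.rpow_ne_top_of_nonneg (by norm_num) (ENNReal.mul_ne_top (ENNReal.mul_ne_top
        (ENNReal.mul_ne_top ENNReal.ofReal_ne_top (ENNReal.natCast_ne_top _)) ?_) ?_))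
    · exact ENNReal.div_ne_top hM hm
    · exact ENNReal.rpow_ne_top_of_nonneg (by norm_num) (ENNReal.div_ne_top hL₁ hm)
  refine max_lt (Ne.lt_top ?_) (Ne.lt_top ?_)
  · unfold threshold₁
    exact ENNReal.div_ne_top (ENNReal.mul_ne_top (ENNReal.mul_ne_top (by simp)
      (ENNReal.pow_ne_top (ENNReal.div_ne_top hM hm))) hL₁) hm
  · unfold threshold₂
    have hBρ := ENNReal.div_ne_top hB (mul_ne_zero (two_ne_zero (α := ℝ≥0∞)) hρ)
    exact ENNReal.pow_ne_top (ENNReal.add_ne_top.2 ⟨hBρ, ENNReal.rpow_ne_top_of_nonneg (by norm_num)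
      (ENNReal.add_ne_top.2 ⟨ENNReal.pow_ne_top hBρ, ENNReal.div_ne_top hA hρ⟩)⟩)

/-- With `a = log(8k²(d+2))` and `ℓ = log(1/ε)`, both at least `log 2`, one has `2aℓ/log 2 ≥ a + ℓ`:
the `a` pays for the factor `6k` and the `ℓ` yields `ε`. -/
theorem six_mul_exp_neg_le {k : ℕ} (d : ℕ) (hk : 1 ≤ k) {ε : ℝ} (h0 : 0 < ε) (h1 : ε < 1 / 2) :
    6 * k * Real.exp (-(logConst d k * Real.log (1 / ε))) ≤ ε := by
  have hk0 : (1 : ℝ) ≤ k := Nat.one_le_cast.2 hk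
  have hl2 := Real.log_pos one_lt_two
  have hinv : 2 < 1 / ε := by rw [lt_div_iff₀ h0]; linarith
  have hℓ : Real.log 2 ≤ Real.log (1 / ε) := Real.log_le_log two_pos hinv.le
  set a := Real.log (8 * (k : ℝ) ^ 2 * ((d : ℝ) + 2)) with ha
  have h16 := sixteen_mul_le d hk
  have ha6 : Real.log (6 * k) ≤ a := Real.log_le_log (by positivity) (by linarith)
  have ha2 : Real.log 2 ≤ a := Real.log_le_log two_pos (by linarith)
  have hsum : a + Real.log (1 / ε) ≤ logConst d k * Real.log (1 / ε) := by
    rw [logConst, ← ha, div_mul_eq_mul_div, div_mul_eq_mul_div, le_div_iff₀ hl2]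
    nlinarith [mul_le_mul_of_nonneg_left hℓ (hl2.le.trans ha2),
      mul_le_mul_of_nonneg_right ha2 (hl2.le.trans hℓ)]
  have hneg : -(logConst d k * Real.log (1 / ε)) ≤ Real.log ε - Real.log (6 * k) := by
    rw [one_div, Real.log_inv] at *
    linarith
  calc _ ≤ 6 * k * Real.exp (Real.log ε - Real.log (6 * k)) := by gcongr
    _ = ε := by
      rw [Real.exp_sub, Real.exp_log h0, Real.exp_log (by positivity)]
      field_simp

theorem recovery_probability_ge (hΓ : Γ.parts.Nonempty) (hprox : 0 < prox X Γ) {ε : ℝ}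
    (hε0 : 0 < ε) (hε1 : ε < 1 / 2) (p : unitInterval)
    (h : shapeParameter X Γ * ENNReal.ofReal (Real.log (1 / ε)) < expectedSketchSize n p) :
    1 - ε ≤ (sketchLaw n p).real (recoveryEvent X Γ.parts.card Γ) := by
  have : IsProbabilityMeasure (sketchLaw n p) := by unfold sketchLaw; infer_instance
  set k := Γ.parts.card with hkdef
  have hk : 1 ≤ k := hΓ.card_pos
  have hl2 := Real.log_pos one_lt_two
  set ℓ := Real.log (1 / ε) with hℓ
  have hℓ0 : 0 < ℓ := Real.log_pos (by rw [lt_div_iff₀ hε0]; linarith)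
  obtain ⟨S₀, hS₀, hmin⟩ := Γ.parts.exists_min_image Finset.card hΓ
  obtain ⟨S₁, hS₁, hmax⟩ := Γ.parts.exists_max_image Finset.card hΓ
  set m : ℝ := (S₀.card : ℝ) with hm
  set M : ℝ := (S₁.card : ℝ) with hM
  have hm0 : 0 < m := Nat.cast_pos.2 (Γ.nonempty_of_mem_parts hS₀).card_pos
  have hmM : m ≤ M := Nat.cast_le.2 (hmin S₁ hS₁)
  have hn0 : (0 : ℝ) < n := by
    refine hm0.trans_le (Nat.cast_le.2 ?_)
    exact (Finset.card_le_univ S₀).trans_eq (Fintype.card_fin n)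
  have hπm0 : 0 < m / n := by positivity
  have hπmin : minFraction Γ ≤ ENNReal.ofReal (m / n) := by
    rw [ENNReal.ofReal_div_of_pos hn0, hm, ENNReal.ofReal_natCast, ENNReal.ofReal_natCast]
    exact iInf₂_le S₀ hS₀
  have hπmax : ENNReal.ofReal (M / n) ≤ maxFraction Γ := by
    rw [ENNReal.ofReal_div_of_pos hn0, hM, ENNReal.ofReal_natCast, ENNReal.ofReal_natCast]
    exact le_iSup₂ (f := fun S (_ : S ∈ Γ.parts) => (S.card : ℝ≥0∞) / (n : ℝ≥0∞)) S₁ hS₁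
  have hkM : 1 ≤ k * (M / n) := by
    rw [← mul_div_assoc, one_le_div hn0]
    calc (n : ℝ) = ∑ S ∈ Γ.parts, (S.card : ℝ) := by
          rw [← Nat.cast_sum, Γ.sum_card_parts, Finset.card_univ, Fintype.card_fin]
      _ ≤ ∑ S ∈ Γ.parts, M := Finset.sum_le_sum fun S hS => Nat.cast_le.2 (hmax S hS)
      _ = k * M := by rw [Finset.sum_const, nsmul_eq_mul]
  rw [expectedSketchSize_eq] at h
  have hreal : ∀ t : ℝ, 0 ≤ t → ENNReal.ofReal t ≤ shapeParameter X Γ → t * ℓ < p * n :=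
    fun t ht hle => by
    refine (ENNReal.ofReal_lt_ofReal_iff_of_nonneg (by positivity)).1 ?_
    rw [ENNReal.ofReal_mul ht]
    exact (mul_le_mul_left hle _).trans_lt h
  set L := logConst d k with hL
  have hL0 : 0 ≤ L := logConst_nonneg d hk
  have h1 := hreal (48 * L / (m / n)) (by positivity)
    ((ofReal_le_threshold₁ hk hπm0 (div_le_div_of_nonneg_right hmM hn0.le)).trans
      ((threshold₁_mono le_rfl le_rfl hπmax hπmin).trans (le_max_left _ _)))
  have hP : 0 < (p : ℝ) * n := lt_of_le_of_lt (by positivity) h1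
  have hp : 0 < (p : ℝ) := pos_of_mul_pos_left hP hn0.le
  set Λ := L * ℓ with hΛ
  set N := (p : ℝ) * m with hN
  have hN0 : 0 < N := mul_pos hp hm0
  have hΛ0 : 0 ≤ Λ := mul_nonneg hL0 hℓ0.le
  have hΛN : 48 * Λ ≤ N := by
    have e : 48 * L / (m / n) * ℓ = 48 * Λ * n / m := by rw [hΛ]; field_simp
    rw [e, div_lt_iff₀ hm0] at h1
    have : 48 * Λ * n ≤ N * n := by rw [hN]; linarith
    exact le_of_mul_le_mul_right this hn0
  set s := Real.sqrt (Λ / N) with hs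
  have hs0 : 0 ≤ s := Real.sqrt_nonneg _
  have hs1 : s ≤ 1 / 4 := by
    rw [hs, Real.sqrt_le_left (by norm_num), div_le_iff₀ hN0]
    linarith
  set r := (radius X Γ).toReal with hr
  have hr0 : 0 ≤ r := ENNReal.toReal_nonneg
  have hrad : radius X Γ = ENNReal.ofReal r := (ENNReal.ofReal_toReal radius_ne_top).symm
  have hrS : ∀ S ∈ Γ.parts, ∀ i ∈ S, ‖X i - centroid X S‖ ≤ r := fun S hS i hi => by
    rw [← dist_eq_norm, ← ENNReal.ofReal_le_ofReal_iff hr0, ← hrad, ← edist_dist]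
    exact le_iSup₂_of_le S hS (le_iSup₂_of_le i hi le_rfl)
  have hmargin : ∀ S ∈ Γ.parts, ∀ T ∈ Γ.parts, S ≠ T → ∀ i ∈ S,
      beta X Γ S T + 4 * r * s * (3 + 4 * r / ‖centroid X S - centroid X T‖) +
          2 * r * Real.sqrt (s * n / m) <
        inner ℝ (X i - (1 / 2 : ℝ) • (centroid X S + centroid X T))
          (direction (centroid X S) (centroid X T)) := fun S hS T hT hST i hi => by
    refine lt_of_lt_of_le ?_ (alpha_le hi)
    have hγ := alpha_sub_beta_pos hprox hS hT hST
    -- If `r = 0`, all error terms vanish and positive proximity is the claim itself.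
    rcases hr0.eq_or_lt with hr00 | hr1
    · rw [← hr00]; simpa using hγ
    have hD : 0 < ‖centroid X S - centroid X T‖ :=
      norm_pos_iff.2 (sub_ne_zero.2 (centroid_ne hprox hS hT hST))
    set γ := alpha X S T - beta X Γ S T with hγdef
    set D := ‖centroid X S - centroid X T‖ with hDdef
    have hδ : separation X Γ / radius X Γ ≤ ENNReal.ofReal (D / r) := by
      rw [ENNReal.ofReal_div_of_pos hr1, hrad, hDdef, ← dist_eq_norm, ← edist_dist]
      exact ENNReal.div_le_div_right (separation_le hS hT hST) _
    have hρ : (prox X Γ).toENNReal / radius X Γ ≤ ENNReal.ofReal (γ / r) := by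
      rw [ENNReal.ofReal_div_of_pos hr1, hrad]
      exact ENNReal.div_le_div_right (EReal.toENNReal_le_toENNReal (prox_le hS hT hST)) _
    have hρ0 : 0 < γ / r := div_pos hγ hr1
    -- The ratios for this pair dominate the global minima, so monotonicity bounds the pair's
    -- threshold by the shape parameter.
    have hroot := (ofReal_le_threshold₂ (mul_nonneg (mul_nonneg (add_nonneg
      (div_nonneg two_pos.le (div_pos hD hr1).le) (by norm_num)) (by norm_num))
        (Real.sqrt_nonneg _)) (mul_nonneg two_pos.le (Real.sqrt_nonneg _)) hρ0
      (ofReal_le_coeffA (d := d) hk (div_pos hD hr1) hπm0)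
      (ofReal_le_coeffB hk hπm0 (div_pos (hm0.trans_le hmM) hn0) hkM)).trans
        ((threshold₂_mono le_rfl le_rfl hπmax hδ hρ hπmin).trans
          (le_max_right (threshold₁ d k (minFraction Γ) (maxFraction Γ)) _))
    have hlt := margin_of_positiveRoot_lt hL0 hℓ0 hp hn0 hm0 hr1 hD hγ
      (hreal _ (pow_nonneg (positiveRoot_nonneg
        (mul_nonneg two_pos.le (Real.sqrt_nonneg _)) hρ0) 4) hroot)
    linarith
  have hsub : {W : Set (Fin n) | IsRepresentative X Γ p s r W.toFinite.toFinset} ⊆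
      recoveryEvent X k Γ := fun W hW =>
    exactlyRecovers_of_isRepresentative hΓ hp hs0 hs1 hr0 hrS hm0
      (fun S hS => Nat.cast_le.2 (hmin S hS)) hmargin hW
  have hfail := sketchLaw_not_isRepresentative_le p X Γ hr0 hrS hN0
    (fun S hS => mul_le_mul_of_nonneg_left (Nat.cast_le.2 (hmin S hS)) p.2.1) hΛ0
    (by linarith)
  have htot : 1 ≤ (sketchLaw n p).real {W : Set (Fin n) |
        IsRepresentative X Γ p s r W.toFinite.toFinset} +
      (sketchLaw n p).real {W : Set (Fin n) |
        ¬ IsRepresentative X Γ p s r W.toFinite.toFinset} := by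
    have hu := measureReal_union_le (μ := sketchLaw n p)
      {W : Set (Fin n) | IsRepresentative X Γ p s r W.toFinite.toFinset}
      {W : Set (Fin n) | ¬ IsRepresentative X Γ p s r W.toFinite.toFinset}
    have huniv : {W : Set (Fin n) | IsRepresentative X Γ p s r W.toFinite.toFinset} ∪
      {W : Set (Fin n) | ¬ IsRepresentative X Γ p s r W.toFinite.toFinset} = Set.univ :=
      Set.eq_univ_of_forall fun W => em _
    rwa [huniv, probReal_univ] at hu
  have hmono := measureReal_mono (μ := sketchLaw n p) hsub
  have hexp := six_mul_exp_neg_le d hk hε0 hε1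
  linarith

end Main

end

end SketchSolve

theorem mainTheorem1 :
    -- (a) finiteness and exact recovery
    (∀ (n d k : ℕ) (X : Fin n → EuclideanSpace ℝ (Fin d))
      (Γ : Finpartition (Finset.univ : Finset (Fin n))),
      Γ.parts.card = k →
      0 < SketchSolve.prox X Γ →
      SketchSolve.radius X Γ ≤ SketchSolve.separation X Γ / 2 →
      SketchSolve.shapeParameter X Γ < ⊤ ∧
      ∀ ε : ℝ, 0 < ε → ε < 1 / 2 → ∀ p : unitInterval,
        SketchSolve.shapeParameter X Γ * ENNReal.ofReal (Real.log (1 / ε)) <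
          SketchSolve.expectedSketchSize n p →
        1 - ε ≤ (SketchSolve.sketchLaw n p).real (SketchSolve.recoveryEvent X k Γ)) ∧
    -- (b) monotonicity of the shape parameter in each of the six quantities
    (∀ (d d' k k' : ℕ) (δ δ' ρ ρ' πmin πmin' πmax πmax' : ENNReal),
      d ≤ d' → k ≤ k' → πmax ≤ πmax' → δ' ≤ δ → ρ' ≤ ρ → πmin' ≤ πmin →
      SketchSolve.shapeFunction d δ ρ k πmin πmax ≤
        SketchSolve.shapeFunction d' δ' ρ' k' πmin' πmax') := by
  refine ⟨fun n d k X Γ hk hprox _ => ⟨SketchSolve.shapeParameter_lt_top hprox,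
    fun ε hε0 hε1 p h => ?_⟩, fun d d' k k' δ δ' ρ ρ' πmin πmin' πmax πmax' hd hk hM hδ hρ hm =>
      SketchSolve.shapeFunction_mono hd hk hM hδ hρ hm⟩
  subst hk
  rcases Γ.parts.eq_empty_or_nonempty with hΓ | hΓ
  -- With no clusters there are no points, so the expected sketch size is zero and the strict rate
  -- inequality is impossible.
  · have hn : n = 0 := by
      have := Γ.sum_card_parts
      rw [hΓ, Finset.sum_empty, Finset.card_univ, Fintype.card_fin] at this
      exact this.symm
    subst hn
    rw [SketchSolve.expectedSketchSize_eq] at h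
    simp at h
  · exact SketchSolve.recovery_probability_ge hΓ hprox hε0 hε1 p h
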